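/- Let $\alpha\in(0,2)$, $\beta\in\mathbb R$ and $m_1,m_2\ge 0$ with $m_1+m_2>0$, and let $$\nu_\alpha(du)=\Big(\frac{m_1}{u^{\alpha+1}}\mathbf 1_{(0,\infty)}(u)+\frac{m_2}{|u|^{\alpha+1}}\mathbf 1_{(-\infty,0)}(u)\Big)\,du .$$ Let $X\sim\mathcal S(\alpha,\beta)$ be a non-Gaussian stable random variable with Lévy measure $\nu_\alpha$, that is, a real random variable with characteristic function $$\mathbb E\,e^{itX}=\exp\Big\{it\beta+\int_{\mathbb R}\Big(e^{itu}-1-\frac{itu}{1+u^2}\Big)\nu_\alpha(du)\Big\},\qquad t\in\mathbb R .$$ Put $$\Gamma_\alpha=\beta-(m_1-m_2)\int_0^\infty\frac{du}{u^\alpha(1+u^2)}\quad\text{if }\alpha\in(0,1),$$ $$\Gamma_\alpha=\beta+2(m_1-m_2)\int_0^1\frac{u^2}{u^\alpha(1+u^2)}\,du-(m_1-m_2)\int_0^\infty\frac{1\wedge u^2}{u^\alpha(1+u^2)}\,du\quad\text{if }\alpha\in[1,2).$$ Let $\mathcal F_X$ be the set of bounded, infinitely differentiable $g:\mathbb R\to\mathbb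 R$ such that $\sup_{x}|x^m g^{(n)}(x)|<\infty$ for all $m,n\in\mathbb N$ and $g^{(k)}(x)\to0$ as $x\to\pm\infty$ for all $k\ge0$. For $g\in\mathcal F_X$ and $x\in\mathbb R$ define $$\mathcal A_\alpha(g)(x)=\begin{cases}(x-\Gamma_\alpha)g(x)-\displaystyle\int_{\mathbb R}g(x+u)\,u\,\nu_\alpha(du),&\alpha\in(0,1),\\[2mm](x-\Gamma_\alpha)g(x)-\displaystyle\int_{\mathbb R}\big(g(x+u)-g(x)\mathbf 1_{\{|u|\le1\}}\big)u\,\nu_\alpha(du),&\alpha\in[1,2).\end{cases}$$ Then $\mathcal A_\alpha$ is a Stein operator for $X$ on $\mathcal F_X$: for every $g\in\mathcal F_X$, the integral defining $\mathcal A_\alpha(g)(x)$ converges absolutely for every $x\in\mathbb R$, the random variable $\mathcal A_\alpha(g)(X)$ is integrable, and $\mathbb E[\mathcal A_\alpha(g)(X)]=0$. -/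

import Mathlib

open MeasureTheory ProbabilityTheory Filter Topology
open scoped ContDiff

noncomputable section

/-- The class of test functions: bounded smooth functions `f : ℝ → ℝ` with
`sup_x |x ^ m * f⁽ⁿ⁾ x| < ∞` for all `m, n`, and all of whose derivatives vanish at `± ∞`. -/
structure SteinTestFunction (f : ℝ → ℝ) : Prop where
  contDiff : ContDiff ℝ ∞ f
  bounded : ∃ C : ℝ, ∀ x : ℝ, |f x| ≤ C
  seminorm_lt_top : ∀ m n : ℕ, ∃ C : ℝ, ∀ x : ℝ, |x ^ m * iteratedDeriv n f x| ≤ C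
  tendsto_atTop : ∀ k : ℕ, Tendsto (iteratedDeriv k f) atTop (𝓝 0)
  tendsto_atBot : ∀ k : ℕ, Tendsto (iteratedDeriv k f) atBot (𝓝 0)

/-- The density of the stable Lévy measure: `m₁ / u ^ (α + 1)` for `u > 0` and
`m₂ / |u| ^ (α + 1)` for `u < 0`. -/
def stableLevyDensity (α m₁ m₂ : ℝ) (u : ℝ) : ℝ :=
  if 0 < u then m₁ / u ^ (α + 1) else if u < 0 then m₂ / |u| ^ (α + 1) else 0

/-- The stable Lévy measure `ν_α` on `ℝ`. -/
def stableLevyMeasure (α m₁ m₂ : ℝ) : Measure ℝ :=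
  (volume : Measure ℝ).withDensity fun u => ENNReal.ofReal (stableLevyDensity α m₁ m₂ u)

/-- The non-Gaussian stable law `S(α, β)` with Lévy measure `ν_α`: the probability measure with
characteristic function
`t ↦ exp (i t β + ∫ (exp (i t u) - 1 - i t u / (1 + u ^ 2)) ν_α(du))`. -/
structure IsNonGaussianStable (α β m₁ m₂ : ℝ) (μ : Measure ℝ) : Prop where
  alpha_pos : 0 < α
  alpha_lt_two : α < 2
  m₁_nonneg : 0 ≤ m₁
  m₂_nonneg : 0 ≤ m₂
  m_pos : 0 < m₁ + m₂
  isProbabilityMeasure : IsProbabilityMeasure μ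
  charFun_eq : ∀ t : ℝ, charFun μ t =
    Complex.exp (Complex.I * t * β +
      ∫ u : ℝ, (Complex.exp (Complex.I * t * u) - 1 - Complex.I * t * u / (1 + (u : ℂ) ^ 2))
        ∂(stableLevyMeasure α m₁ m₂))

/-- The drift constant `Γ_α`. -/
def stableGamma (α β m₁ m₂ : ℝ) : ℝ :=
  if α < 1 then
    β - (m₁ - m₂) * ∫ u in Set.Ioi (0 : ℝ), 1 / (u ^ α * (1 + u ^ 2))
  else
    β + 2 * (m₁ - m₂) * (∫ u in Set.Ioc (0 : ℝ) 1, u ^ 2 / (u ^ α * (1 + u ^ 2)))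
      - (m₁ - m₂) * ∫ u in Set.Ioi (0 : ℝ), min 1 (u ^ 2) / (u ^ α * (1 + u ^ 2))

/-- The integrand, against `ν_α(du)`, of the nonlocal part of the Stein operator. -/
def stableSteinIntegrand (α : ℝ) (g : ℝ → ℝ) (x u : ℝ) : ℝ :=
  if α < 1 then g (x + u) * u
  else (g (x + u) - g x * Set.indicator {v : ℝ | |v| ≤ 1} 1 u) * u

/-- The operator `A_α`. -/
def stableSteinOperator (α β m₁ m₂ : ℝ) (g : ℝ → ℝ) (x : ℝ) : ℝ :=
  (x - stableGamma α β m₁ m₂) * g x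
    - ∫ u : ℝ, stableSteinIntegrand α g x u ∂(stableLevyMeasure α m₁ m₂)

end

open scoped SchwartzMap

noncomputable section

/-- The character `u ↦ exp (i t u)`. -/
def osc (t u : ℝ) : ℂ := Complex.exp (Complex.I * t * u)

/-- The indicator of the small jumps `|u| ≤ 1`. -/
def smallJump (u : ℝ) : ℝ := Set.indicator {v : ℝ | |v| ≤ 1} 1 u

lemma osc_eq (t u : ℝ) : osc t u = Complex.exp (Complex.I * ((t * u : ℝ) : ℂ)) := by
  simp [osc, mul_assoc]

lemma osc_comm (t u : ℝ) : osc t u = osc u t := by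
  rw [osc_eq, osc_eq, mul_comm t u]

lemma osc_add (t x u : ℝ) : osc t (x + u) = osc t x * osc t u := by
  simp only [osc, ← Complex.exp_add]; congr 1; push_cast; ring

lemma norm_osc (t u : ℝ) : ‖osc t u‖ = 1 := by
  rw [osc_eq, mul_comm, Complex.norm_exp_ofReal_mul_I]

lemma continuous_osc_uncurry : Continuous fun p : ℝ × ℝ => osc p.1 p.2 := by
  unfold osc; fun_prop

lemma measurable_osc_uncurry : Measurable fun p : ℝ × ℝ => osc p.1 p.2 :=
  continuous_osc_uncurry.measurable

@[fun_prop]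
lemma continuous_osc (t : ℝ) : Continuous (osc t) := by
  unfold osc; fun_prop

lemma continuous_osc_left (u : ℝ) : Continuous fun t => osc t u := by
  unfold osc; fun_prop

@[fun_prop]
lemma measurable_osc (t : ℝ) : Measurable (osc t) := (continuous_osc t).measurable

lemma hasDerivAt_osc (t u : ℝ) : HasDerivAt (fun s => osc s u) (Complex.I * u * osc t u) t := by
  have h : HasDerivAt (fun s : ℝ => Complex.I * (s : ℂ) * (u : ℂ)) (Complex.I * u) t := by
    have := ((Complex.ofRealCLM.hasDerivAt (x := t)).const_mul Complex.I).mul_const (u : ℂ)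
    simpa using this
  have h2 := h.cexp
  unfold osc
  convert h2 using 1
  ring

lemma norm_osc_sub_one_le (t u : ℝ) : ‖osc t u - 1‖ ≤ |t| * |u| := by
  rw [osc_eq, ← abs_mul]; exact Real.norm_exp_I_mul_ofReal_sub_one_le

lemma norm_osc_sub_one_le_two (t u : ℝ) : ‖osc t u - 1‖ ≤ 2 := by
  calc _ ≤ ‖osc t u‖ + ‖(1 : ℂ)‖ := norm_sub_le _ _
    _ = 2 := by rw [norm_osc, norm_one]; norm_num

lemma norm_osc_sub_one_sub_le (t u : ℝ) :
    ‖osc t u - 1 - Complex.I * t * u‖ ≤ 3 * (t * u) ^ 2 := by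
  have hn : ‖Complex.I * t * u‖ = |t * u| := by simp [abs_mul]
  rcases le_total |t * u| 1 with h | h
  · have := Complex.norm_exp_sub_one_sub_id_le (x := Complex.I * t * u) (by rwa [hn])
    rw [hn, sq_abs] at this
    unfold osc
    nlinarith [sq_nonneg (t * u)]
  · have h1 := norm_sub_le (osc t u - 1) (Complex.I * t * u)
    rw [hn] at h1
    have h2 := norm_osc_sub_one_le_two t u
    nlinarith [sq_abs (t * u)]

lemma smallJump_of_le {u : ℝ} (h : |u| ≤ 1) : smallJump u = 1 := by
  simp [smallJump, h]

lemma smallJump_of_lt {u : ℝ} (h : 1 < |u|) : smallJump u = 0 := by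
  simp [smallJump, h]

@[fun_prop]
lemma measurable_smallJump : Measurable smallJump :=
  measurable_one.indicator (measurableSet_le measurable_norm measurable_const)

/-- The compensated exponent `exp (i t u) - 1 - i t u 1_{|u| ≤ 1}`. -/
def compExp (t u : ℝ) : ℂ := osc t u - 1 - Complex.I * t * u * smallJump u

/-- The kernel `(exp (i t u) - 1_{|u| ≤ 1}) u`. -/
def compKernel (t u : ℝ) : ℂ := (osc t u - smallJump u) * u

@[fun_prop]
lemma measurable_compExp (t : ℝ) : Measurable (compExp t) := by
  unfold compExp; fun_prop

lemma measurable_compKernel_uncurry : Measurable fun p : ℝ × ℝ => compKernel p.1 p.2 := by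
  unfold compKernel
  have := measurable_osc_uncurry
  fun_prop

lemma measurable_compKernel_swap : Measurable fun p : ℝ × ℝ => compKernel p.2 p.1 := by
  unfold compKernel
  have : Measurable fun p : ℝ × ℝ => osc p.2 p.1 := measurable_osc_uncurry.comp measurable_swap
  fun_prop

@[fun_prop]
lemma measurable_compKernel (t : ℝ) : Measurable (compKernel t) := by
  unfold compKernel; fun_prop

lemma min_one_sq_of_le {u : ℝ} (h : |u| ≤ 1) : min 1 (u ^ 2) = u ^ 2 :=
  min_eq_right (by rw [← sq_abs]; nlinarith [abs_nonneg u])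

lemma min_one_sq_of_lt {u : ℝ} (h : 1 < |u|) : min 1 (u ^ 2) = 1 :=
  min_eq_left (by rw [← sq_abs]; nlinarith [abs_nonneg u])

lemma norm_compExp_le (t u : ℝ) : ‖compExp t u‖ ≤ 3 * (1 + t ^ 2) * min 1 (u ^ 2) := by
  unfold compExp
  rcases le_or_gt |u| 1 with h | h
  · rw [smallJump_of_le h, min_one_sq_of_le h]
    have := norm_osc_sub_one_sub_le t u
    simp only [Complex.ofReal_one, mul_one]
    nlinarith [sq_nonneg u]
  · rw [smallJump_of_lt h, min_one_sq_of_lt h]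
    have := norm_osc_sub_one_le_two t u
    simp only [Complex.ofReal_zero, mul_zero, sub_zero]
    nlinarith [sq_nonneg t]

lemma norm_compKernel_le {R t u : ℝ} (hu : |u| ≤ R) (hR : 0 ≤ R) :
    ‖compKernel t u‖ ≤ (|t| + R) * min 1 (u ^ 2) := by
  unfold compKernel
  rw [norm_mul, Complex.norm_real, Real.norm_eq_abs]
  rcases le_or_gt |u| 1 with h | h
  · rw [smallJump_of_le h, min_one_sq_of_le h, ← sq_abs u]
    have := norm_osc_sub_one_le t u
    simp only [Complex.ofReal_one]
    nlinarith [abs_nonneg u, abs_nonneg t, mul_nonneg hR (sq_nonneg |u|)]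
  · rw [smallJump_of_lt h, min_one_sq_of_lt h]
    simp only [Complex.ofReal_zero, sub_zero, norm_osc]
    nlinarith [abs_nonneg t]

lemma hasDerivAt_compExp (t u : ℝ) :
    HasDerivAt (fun s => compExp s u) (Complex.I * compKernel t u) t := by
  have h : HasDerivAt (fun s : ℝ => Complex.I * (s : ℂ) * (u : ℂ) * smallJump u)
      (Complex.I * u * smallJump u) t := by
    have := (((Complex.ofRealCLM.hasDerivAt (x := t)).const_mul Complex.I).mul_const
      (u : ℂ)).mul_const (smallJump u : ℂ)
    simpa using this
  refine (((hasDerivAt_osc t u).sub_const 1).sub h).congr_deriv ?_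
  unfold compKernel
  ring

lemma re_compExp_nonpos (t u : ℝ) : (compExp t u).re ≤ 0 := by
  have h1 : (osc t u).re ≤ 1 := (Complex.re_le_norm _).trans (norm_osc t u).le
  have h2 : compExp t u = osc t u - 1 - Complex.I * ((t * u * smallJump u : ℝ) : ℂ) := by
    unfold compExp; push_cast; ring
  rw [h2, Complex.sub_re, Complex.sub_re, Complex.I_mul_re, Complex.ofReal_im, Complex.one_re]
  linarith

lemma Complex.norm_exp_sub_exp_le_of_re_nonpos {a b : ℂ} (ha : a.re ≤ 0) (hb : b.re ≤ 0) :
    ‖Complex.exp a - Complex.exp b‖ ≤ ‖a - b‖ := by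
  have h := (convex_halfSpace_re_le 0).norm_image_sub_le_of_norm_hasDerivWithin_le
    (f := Complex.exp) (f' := Complex.exp) (C := 1)
    (fun x _ => (Complex.hasDerivAt_exp x).hasDerivWithinAt)
    (fun x hx => by rw [Complex.norm_exp]; exact Real.exp_le_one_iff.2 hx) hb ha
  simpa using h

section LevyMeasure

variable {ν : Measure ℝ}

lemma measurableSet_abs_le (R : ℝ) : MeasurableSet {u : ℝ | |u| ≤ R} :=
  measurableSet_le measurable_norm measurable_const

lemma measurableSet_lt_abs (R : ℝ) : MeasurableSet {u : ℝ | R < |u|} :=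
  measurableSet_lt measurable_const measurable_norm

lemma compl_abs_le (R : ℝ) : {u : ℝ | |u| ≤ R}ᶜ = {u : ℝ | R < |u|} := by
  ext; simp

/-- The exponent of the Lévy measure truncated to `|u| ≤ R`. -/
def truncExponent (ν : Measure ℝ) (R t : ℝ) : ℂ := ∫ u in {u : ℝ | |u| ≤ R}, compExp t u ∂ν

/-- The derivative (up to `i`) of the truncated exponent. -/
def truncKernel (ν : Measure ℝ) (R t : ℝ) : ℂ := ∫ u in {u : ℝ | |u| ≤ R}, compKernel t u ∂ν


lemma integrable_compExp (hν : Integrable (fun u => min 1 (u ^ 2)) ν) (t : ℝ) :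
    Integrable (compExp t) ν :=
  (hν.const_mul (3 * (1 + t ^ 2))).mono' (measurable_compExp t).aestronglyMeasurable
    (ae_of_all _ fun u => norm_compExp_le t u)

lemma integrableOn_compKernel (hν : Integrable (fun u => min 1 (u ^ 2)) ν) {R : ℝ} (hR : 0 ≤ R)
    (t : ℝ) :
    IntegrableOn (compKernel t) {u : ℝ | |u| ≤ R} ν :=
  ((hν.const_mul (|t| + R)).integrableOn).mono' (measurable_compKernel t).aestronglyMeasurable
    ((ae_restrict_iff' (measurableSet_abs_le R)).2 (ae_of_all _ fun _ hu =>
      norm_compKernel_le hu hR))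

lemma measure_lt_abs_lt_top (hν : Integrable (fun u => min 1 (u ^ 2)) ν) {R : ℝ} (hR : 1 ≤ R) :
    ν {u : ℝ | R < |u|} < ⊤ := by
  have h := hν.measure_ge_lt_top (ε := 1) one_pos
  refine (measure_mono fun u hu => ?_).trans_lt h
  have hu' : 1 < |u| := hR.trans_lt hu
  exact (min_one_sq_of_lt hu').ge

lemma hasDerivAt_truncExponent (hν : Integrable (fun u => min 1 (u ^ 2)) ν) {R : ℝ} (hR : 0 ≤ R)
    (t : ℝ) :
    HasDerivAt (truncExponent ν R) (Complex.I * truncKernel ν R t) t := by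
  have h := (hasDerivAt_integral_of_dominated_loc_of_deriv_le (𝕜 := ℝ)
    (μ := ν.restrict {u : ℝ | |u| ≤ R}) (F := compExp)
    (F' := fun t u => Complex.I * compKernel t u) (x₀ := t)
    (bound := fun u => (|t| + 1 + R) * min 1 (u ^ 2)) (Metric.ball_mem_nhds t one_pos)
    (Eventually.of_forall fun s => (measurable_compExp s).aestronglyMeasurable)
    (integrable_compExp hν t).integrableOn
    ((measurable_compKernel t).const_mul _).aestronglyMeasurable
    ((ae_restrict_iff' (measurableSet_abs_le R)).2 (ae_of_all _ fun u hu s hs => ?_))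
    (hν.const_mul _).integrableOn
    (ae_of_all _ fun u s _ => hasDerivAt_compExp s u)).2
  · rw [integral_const_mul] at h
    exact h
  · rw [norm_mul, Complex.norm_I, one_mul]
    refine (norm_compKernel_le hu hR).trans ?_
    have : |s| ≤ |t| + 1 := by
      have h1 := abs_sub_abs_le_abs_sub s t
      have h2 : |s - t| < 1 := by simpa [Real.dist_eq] using hs
      linarith
    have h0 : (0 : ℝ) ≤ min 1 (u ^ 2) := by positivity
    gcongr

lemma norm_truncKernel_le (hν : Integrable (fun u => min 1 (u ^ 2)) ν) {R : ℝ} (hR : 0 ≤ R)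
    (t : ℝ) :
    ‖truncKernel ν R t‖ ≤ (|t| + R) * ∫ u, min 1 (u ^ 2) ∂ν := by
  unfold truncKernel
  rw [← integral_const_mul]
  refine (norm_integral_le_of_norm_le (hν.const_mul (|t| + R)).integrableOn
    ((ae_restrict_iff' (measurableSet_abs_le R)).2 (ae_of_all _ fun u hu =>
      norm_compKernel_le hu hR))).trans ?_
  refine setIntegral_le_integral (hν.const_mul _) (ae_of_all _ fun u => ?_)
  have : 0 ≤ |t| + R := by positivity
  have h0 : (0 : ℝ) ≤ min 1 (u ^ 2) := by positivity
  exact mul_nonneg this h0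

lemma norm_truncKernel_le_add (hν : Integrable (fun u => min 1 (u ^ 2)) ν) {R : ℝ} (hR : 1 ≤ R)
    (t : ℝ) :
    ‖truncKernel ν R t‖ ≤ |t| * (∫ u, min 1 (u ^ 2) ∂ν) +
      ‖∫ u in {u : ℝ | 1 < |u| ∧ |u| ≤ R}, osc t u * u ∂ν‖ := by
  have hR0 : 0 ≤ R := by linarith
  have hm : MeasurableSet {u : ℝ | 1 < |u| ∧ |u| ≤ R} :=
    (measurableSet_lt_abs 1).inter (measurableSet_abs_le R)
  have hs : {u : ℝ | |u| ≤ R} = {u : ℝ | |u| ≤ 1} ∪ {u : ℝ | 1 < |u| ∧ |u| ≤ R} := by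
    ext u; simp only [Set.mem_ofPred_eq, Set.mem_union]
    constructor
    · intro h; rcases le_or_gt |u| 1 with h1 | h1
      · exact Or.inl h1
      · exact Or.inr ⟨h1, h⟩
    · rintro (h | h)
      · exact h.trans hR
      · exact h.2
  have hd : Disjoint {u : ℝ | |u| ≤ 1} {u : ℝ | 1 < |u| ∧ |u| ≤ R} :=
    Set.disjoint_left.2 fun u h1 h2 => not_lt.2 h1 h2.1
  have hI := integrableOn_compKernel hν hR0 t
  have e1 : truncKernel ν R t = (∫ u in {u : ℝ | |u| ≤ 1}, compKernel t u ∂ν) +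
      ∫ u in {u : ℝ | 1 < |u| ∧ |u| ≤ R}, compKernel t u ∂ν := by
    unfold truncKernel
    rw [hs] at hI ⊢
    exact setIntegral_union hd hm (hI.mono_set Set.subset_union_left)
      (hI.mono_set Set.subset_union_right)
  have e2 : ∫ u in {u : ℝ | 1 < |u| ∧ |u| ≤ R}, compKernel t u ∂ν =
      ∫ u in {u : ℝ | 1 < |u| ∧ |u| ≤ R}, osc t u * u ∂ν :=
    setIntegral_congr_fun hm fun u hu => by simp [compKernel, smallJump_of_lt hu.1]
  have e3 : ‖∫ u in {u : ℝ | |u| ≤ 1}, compKernel t u ∂ν‖ ≤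
      |t| * ∫ u, min 1 (u ^ 2) ∂ν := by
    rw [← integral_const_mul]
    refine (norm_integral_le_of_norm_le (hν.const_mul |t|).integrableOn
      ((ae_restrict_iff' (measurableSet_abs_le 1)).2 (ae_of_all _ fun u (hu : |u| ≤ 1) => ?_))).trans ?_
    · rw [compKernel, smallJump_of_le hu, min_one_sq_of_le hu, norm_mul, Complex.norm_real,
        Real.norm_eq_abs, Complex.ofReal_one, ← sq_abs u]
      nlinarith [abs_nonneg u, norm_osc_sub_one_le t u]
    · refine setIntegral_le_integral (hν.const_mul _) (ae_of_all _ fun u => ?_)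
      have h0 : (0 : ℝ) ≤ min 1 (u ^ 2) := by positivity
      exact mul_nonneg (abs_nonneg t) h0
  rw [e1, e2]
  exact (norm_add_le _ _).trans (by gcongr)

lemma norm_truncExponent_sub_le (hν : Integrable (fun u => min 1 (u ^ 2)) ν) {R : ℝ} (hR : 1 ≤ R)
    (t : ℝ) :
    ‖truncExponent ν R t - ∫ u, compExp t u ∂ν‖ ≤ 2 * ν.real {u : ℝ | R < |u|} := by
  rw [← integral_add_compl (measurableSet_abs_le R) (integrable_compExp hν t), compl_abs_le,
    truncExponent, sub_add_cancel_left, norm_neg]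
  refine norm_setIntegral_le_of_norm_le_const (measure_lt_abs_lt_top hν hR) fun u hu => ?_
  have hu' : 1 < |u| := hR.trans_lt hu
  simpa [compExp, smallJump_of_lt hu'] using norm_osc_sub_one_le_two t u

lemma re_integral_compExp_nonpos (ν : Measure ℝ) (t : ℝ) : (∫ u, compExp t u ∂ν).re ≤ 0 := by
  by_cases h : Integrable (compExp t) ν
  · have : (∫ u, compExp t u ∂ν).re = ∫ u, (compExp t u).re ∂ν :=
      (integral_re h).symm
    rw [this]
    exact integral_nonpos fun u => re_compExp_nonpos t u
  · rw [integral_undef h]; simp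

end LevyMeasure

/-- The function `x ↦ ∫ f(t) exp (i t x) dt`. -/
def oscIntegral (f : ℝ → ℂ) (x : ℝ) : ℂ := ∫ t, f t * osc t x

lemma integrable_mul_osc {f : ℝ → ℂ} (hf : Integrable f) (x : ℝ) :
    Integrable fun t => f t * osc t x :=
  hf.mul_bdd (c := 1) (continuous_osc_left x).aestronglyMeasurable
    (ae_of_all _ fun t => (norm_osc t x).le)

lemma integrable_mul_osc_prod {f : ℝ → ℂ} (hf : Integrable f) (μ : Measure ℝ)
    [IsFiniteMeasure μ] : Integrable (fun p : ℝ × ℝ => f p.2 * osc p.2 p.1) (μ.prod volume) := by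
  have h1 : Integrable (fun p : ℝ × ℝ => (1 : ℂ) * f p.2) (μ.prod volume) :=
    (integrable_const 1).mul_prod hf
  simp only [one_mul] at h1
  exact h1.mul_bdd (c := 1)
    (continuous_osc_uncurry.comp continuous_swap).aestronglyMeasurable
    (ae_of_all _ fun p => (norm_osc _ _).le)

lemma charFun_eq_integral_osc (μ : Measure ℝ) (t : ℝ) : charFun μ t = ∫ x, osc t x ∂μ := by
  rw [charFun_apply_real]
  refine integral_congr_ae (ae_of_all _ fun x => ?_)
  simp only [osc]; congr 1; ring

lemma integrable_oscIntegral {f : ℝ → ℂ} (hf : Integrable f) (μ : Measure ℝ)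
    [IsFiniteMeasure μ] : Integrable (oscIntegral f) μ :=
  (integrable_mul_osc_prod hf μ).integral_prod_left

lemma integral_oscIntegral {f : ℝ → ℂ} (hf : Integrable f) (μ : Measure ℝ)
    [IsFiniteMeasure μ] : ∫ x, oscIntegral f x ∂μ = ∫ t, f t * charFun μ t := by
  have h := integral_integral_swap (μ := μ) (ν := volume) (f := fun x t => f t * osc t x)
    (integrable_mul_osc_prod hf μ)
  unfold oscIntegral
  rw [h]
  refine integral_congr_ae (ae_of_all _ fun t => ?_)
  simp only [integral_const_mul, charFun_eq_integral_osc]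

lemma SchwartzMap.integrable_deriv (f : 𝓢(ℝ, ℂ)) : Integrable (deriv f) := by
  have h := (SchwartzMap.derivCLM ℂ ℂ f).integrable (μ := volume)
  exact h.congr (ae_of_all _ fun x => SchwartzMap.derivCLM_apply ℂ f x)

lemma SchwartzMap.hasDerivAt_deriv (f : 𝓢(ℝ, ℂ)) (t : ℝ) : HasDerivAt f (deriv f t) t :=
  f.differentiableAt.hasDerivAt

lemma SchwartzMap.integrable_abs_mul (f : 𝓢(ℝ, ℂ)) : Integrable fun t => |t| * ‖f t‖ := by
  simpa using f.integrable_pow_mul volume 1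

lemma mul_oscIntegral (f : 𝓢(ℝ, ℂ)) (x : ℝ) :
    (x : ℂ) * oscIntegral f x = Complex.I * oscIntegral (deriv f) x := by
  have h := integral_mul_deriv_eq_deriv_mul_of_integrable (u := f) (u' := deriv f)
    (v := fun t => osc t x) (v' := fun t => Complex.I * x * osc t x)
    (fun t _ => f.hasDerivAt_deriv t) (fun t _ => hasDerivAt_osc t x)
    (((integrable_mul_osc f.integrable x).const_mul (Complex.I * x)).congr
      (ae_of_all _ fun t => by simp only [Pi.mul_apply]; ring))
    (integrable_mul_osc f.integrable_deriv x) (integrable_mul_osc f.integrable x)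
  have h2 : ∫ t, f t * (Complex.I * x * osc t x) = Complex.I * x * oscIntegral f x := by
    unfold oscIntegral
    rw [← integral_const_mul]
    exact integral_congr_ae (ae_of_all _ fun t => by ring)
  rw [h2] at h
  unfold oscIntegral at h ⊢
  linear_combination (-Complex.I) * h + (x * (∫ t, f t * osc t x)) * Complex.I_sq

lemma continuous_oscIntegral {f : ℝ → ℂ} (hf : Integrable f) : Continuous (oscIntegral f) :=
  continuous_of_dominated
    (fun x => (integrable_mul_osc hf x).aestronglyMeasurable)
    (fun x => ae_of_all _ fun t => by rw [norm_mul, norm_osc, mul_one]) hf.norm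
    (ae_of_all _ fun t => continuous_const.mul (continuous_osc t))

section Levy

variable {ν : Measure ℝ}

lemma measurable_truncKernel [SFinite ν] (R : ℝ) : Measurable (truncKernel ν R) := by
  have h : StronglyMeasurable (Function.uncurry compKernel) :=
    measurable_compKernel_uncurry.stronglyMeasurable
  exact (h.integral_prod_right (ν := ν.restrict {u : ℝ | |u| ≤ R})).measurable

lemma integrable_mul_truncKernel [SFinite ν] (hν : Integrable (fun u => min 1 (u ^ 2)) ν)
    (f : 𝓢(ℝ, ℂ)) {R : ℝ} (hR : 0 ≤ R) : Integrable fun t => f t * truncKernel ν R t := by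
  have hb : Integrable fun t => (|t| * ‖f t‖ + R * ‖f t‖) * ∫ u, min 1 (u ^ 2) ∂ν :=
    (f.integrable_abs_mul.add (f.integrable.norm.const_mul R)).mul_const _
  refine hb.mono' (f.continuous.aestronglyMeasurable.mul
    (measurable_truncKernel R).aestronglyMeasurable) (ae_of_all _ fun t => ?_)
  rw [norm_mul]
  calc ‖f t‖ * ‖truncKernel ν R t‖ ≤ ‖f t‖ * ((|t| + R) * ∫ u, min 1 (u ^ 2) ∂ν) := by
        gcongr; exact norm_truncKernel_le hν hR t
    _ = _ := by ring

/-- The compensated increment of `G` in the jump variable. -/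
def compIncrement (G : ℝ → ℂ) (x u : ℝ) : ℂ := (G (x + u) - G x * smallJump u) * u

lemma compIncrement_oscIntegral {f : ℝ → ℂ} (hf : Integrable f) (x u : ℝ) :
    compIncrement (oscIntegral f) x u = ∫ t, f t * osc t x * compKernel t u := by
  have h1 : (smallJump u : ℂ) * oscIntegral f x = ∫ t, smallJump u * (f t * osc t x) := by
    rw [integral_const_mul]; rfl
  have h2 : oscIntegral f (x + u) - oscIntegral f x * smallJump u =
      ∫ t, f t * osc t x * (osc t u - smallJump u) := by
    rw [mul_comm, h1]
    unfold oscIntegral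
    rw [← integral_sub (integrable_mul_osc hf _) ((integrable_mul_osc hf x).const_mul _)]
    refine integral_congr_ae (ae_of_all _ fun t => ?_)
    simp only [osc_add]; ring
  unfold compIncrement
  rw [h2, ← integral_mul_const]
  refine integral_congr_ae (ae_of_all _ fun t => ?_)
  simp only [compKernel]; ring

lemma setIntegral_compIncrement_oscIntegral [SFinite ν]
    (hν : Integrable (fun u => min 1 (u ^ 2)) ν)
    (f : 𝓢(ℝ, ℂ)) {R : ℝ} (hR : 0 ≤ R) (x : ℝ) :
    ∫ u in {u : ℝ | |u| ≤ R}, compIncrement (oscIntegral f) x u ∂ν =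
      oscIntegral (fun t => f t * truncKernel ν R t) x := by
  have hb : Integrable (fun p : ℝ × ℝ => min 1 (p.1 ^ 2) * (|p.2| * ‖f p.2‖ + R * ‖f p.2‖))
      ((ν.restrict {u : ℝ | |u| ≤ R}).prod volume) :=
    hν.restrict.mul_prod (f.integrable_abs_mul.add (f.integrable.norm.const_mul R))
  have hm : AEStronglyMeasurable (fun p : ℝ × ℝ => f p.2 * osc p.2 x * compKernel p.2 p.1)
      ((ν.restrict {u : ℝ | |u| ≤ R}).prod volume) := by
    refine Measurable.aestronglyMeasurable ?_
    refine Measurable.mul (Measurable.mul ?_ ?_) ?_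
    · exact f.continuous.measurable.comp measurable_snd
    · exact (continuous_osc_left x).measurable.comp measurable_snd
    · exact measurable_compKernel_swap
  have hae : ∀ᵐ p ∂((ν.restrict {u : ℝ | |u| ≤ R}).prod (volume : Measure ℝ)), |p.1| ≤ R := by
    have h := (Measure.quasiMeasurePreserving_fst (μ := ν.restrict {u : ℝ | |u| ≤ R})
      (ν := (volume : Measure ℝ))).ae (ae_restrict_mem (measurableSet_abs_le R))
    exact h
  have hI := hb.mono' hm (hae.mono fun p hp => by
    rw [norm_mul, norm_mul, norm_osc, mul_one]
    calc ‖f p.2‖ * ‖compKernel p.2 p.1‖ ≤ ‖f p.2‖ * ((|p.2| + R) * min 1 (p.1 ^ 2)) := by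
          gcongr; exact norm_compKernel_le hp hR
      _ = _ := by ring)
  have hsw := integral_integral_swap (μ := ν.restrict {u : ℝ | |u| ≤ R}) (ν := volume)
    (f := fun u t => f t * osc t x * compKernel t u) hI
  simp only [compIncrement_oscIntegral f.integrable]
  rw [hsw]
  unfold oscIntegral
  refine integral_congr_ae (ae_of_all _ fun t => ?_)
  simp only [integral_const_mul, truncKernel]; ring

/-- The characteristic function with drift `γ` and exponent `ψ`. -/
def levyExp (γ : ℝ) (ψ : ℝ → ℂ) (t : ℝ) : ℂ := Complex.exp (Complex.I * t * γ + ψ t)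

lemma norm_levyExp_le_one {γ t : ℝ} {ψ : ℝ → ℂ} (h : (ψ t).re ≤ 0) : ‖levyExp γ ψ t‖ ≤ 1 := by
  rw [levyExp, Complex.norm_exp]
  refine Real.exp_le_one_iff.2 ?_
  simpa using h

lemma norm_levyExp_sub_le {γ t : ℝ} {ψ χ : ℝ → ℂ} (h : (ψ t).re ≤ 0) (h' : (χ t).re ≤ 0) :
    ‖levyExp γ ψ t - levyExp γ χ t‖ ≤ ‖ψ t - χ t‖ := by
  refine (Complex.norm_exp_sub_exp_le_of_re_nonpos ?_ ?_).trans_eq ?_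
  · simpa using h
  · simpa using h'
  · rw [add_sub_add_left_eq_sub]

lemma hasDerivAt_levyExp (hν : Integrable (fun u => min 1 (u ^ 2)) ν) {R : ℝ} (hR : 0 ≤ R)
    (γ t : ℝ) : HasDerivAt (levyExp γ (truncExponent ν R))
      (Complex.I * (γ + truncKernel ν R t) * levyExp γ (truncExponent ν R) t) t := by
  have h1 : HasDerivAt (fun s : ℝ => Complex.I * (s : ℂ) * (γ : ℂ)) (Complex.I * γ) t := by
    have := ((Complex.ofRealCLM.hasDerivAt (x := t)).const_mul Complex.I).mul_const (γ : ℂ)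
    simpa using this
  refine (h1.add (hasDerivAt_truncExponent hν hR t)).cexp.congr_deriv ?_
  simp only [levyExp, Pi.add_apply]; ring

lemma integral_deriv_mul_levyExp [SFinite ν] (hν : Integrable (fun u => min 1 (u ^ 2)) ν)
    (f : 𝓢(ℝ, ℂ)) {R : ℝ} (hR : 0 ≤ R) (γ : ℝ) :
    Complex.I * ∫ t, deriv f t * levyExp γ (truncExponent ν R) t =
      γ * (∫ t, f t * levyExp γ (truncExponent ν R) t) +
        ∫ t, f t * truncKernel ν R t * levyExp γ (truncExponent ν R) t := by
  set φ := levyExp γ (truncExponent ν R) with hφ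
  have hd : ∀ t, HasDerivAt φ (Complex.I * (γ + truncKernel ν R t) * φ t) t := fun t =>
    hasDerivAt_levyExp hν hR γ t
  have hc : Continuous φ := continuous_iff_continuousAt.2 fun t => (hd t).continuousAt
  have hb : ∀ t, ‖φ t‖ ≤ 1 := fun t => norm_levyExp_le_one (re_integral_compExp_nonpos _ t)
  have hI : ∀ F : ℝ → ℂ, Integrable F → Integrable (fun t => F t * φ t) := fun F hF =>
    hF.mul_bdd (c := 1) hc.aestronglyMeasurable (ae_of_all _ hb)
  have i1 := hI _ f.integrable
  have i2 := hI _ (integrable_mul_truncKernel hν f hR)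
  have i3 := hI _ f.integrable_deriv
  have e : ∀ t, f t * (Complex.I * (γ + truncKernel ν R t) * φ t) =
      Complex.I * (γ * (f t * φ t) + f t * truncKernel ν R t * φ t) := fun t => by ring
  have i4 : Integrable fun t => f t * (Complex.I * (γ + truncKernel ν R t) * φ t) := by
    simp only [e]
    exact ((i1.const_mul _).add i2).const_mul _
  have h := integral_mul_deriv_eq_deriv_mul_of_integrable (u := f) (u' := deriv f) (v := φ)
    (v' := fun t => Complex.I * (γ + truncKernel ν R t) * φ t)
    (fun t _ => f.hasDerivAt_deriv t) (fun t _ => hd t) i4 i3 i1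
  simp only [e] at h
  rw [integral_const_mul, integral_add (i1.const_mul _) i2, integral_const_mul] at h
  linear_combination Complex.I * h - (γ * (∫ t, f t * φ t) +
        ∫ t, f t * truncKernel ν R t * φ t) * Complex.I_sq

end Levy

lemma integrable_abs_rpow_mul (f : 𝓢(ℝ, ℂ)) {s : ℝ} (hs0 : 0 ≤ s) (hs1 : s < 1) :
    Integrable fun t : ℝ => |t| ^ (-s) * ‖f t‖ := by
  obtain ⟨C, hC⟩ := f.decay 0 0
  have hC' : ∀ t, ‖f t‖ ≤ C := fun t => by simpa using hC.2 t
  have h1 : IntegrableOn (fun t : ℝ => |t| ^ (-s)) (Set.Icc (-1) 1) := by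
    have hpos : IntegrableOn (fun t : ℝ => |t| ^ (-s)) (Set.Ioc 0 1) := by
      have := (intervalIntegral.intervalIntegrable_rpow' (a := 0) (b := 1) (r := -s)
        (by linarith)).1
      exact this.congr_fun (fun t ht => by simp only [abs_of_pos ht.1]) measurableSet_Ioc
    have hneg : IntegrableOn (fun t : ℝ => |t| ^ (-s)) (Set.Ico (-1) 0) := by
      have := hpos.comp_neg
      simpa using this
    rw [← Set.Ico_union_Icc_eq_Icc (b := 0) (by norm_num) (by norm_num)]
    exact hneg.union ((integrableOn_Icc_iff_integrableOn_Ioc).2 hpos)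
  have h2 : Integrable fun t : ℝ => C * (Set.Icc (-1) 1).indicator (fun t : ℝ => |t| ^ (-s)) t
      + ‖f t‖ := ((h1.integrable_indicator measurableSet_Icc).const_mul C).add f.integrable.norm
  refine h2.mono' ?_ (ae_of_all _ fun t => ?_)
  · have := f.continuous.measurable
    exact Measurable.aestronglyMeasurable (by fun_prop)
  · have hp : 0 ≤ |t| ^ (-s) := by positivity
    rw [Real.norm_of_nonneg (by positivity)]
    by_cases ht : t ∈ Set.Icc (-1 : ℝ) 1
    · rw [Set.indicator_of_mem ht]
      nlinarith [hC' t, norm_nonneg (f t)]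
    · rw [Set.indicator_of_notMem ht]
      have : 1 ≤ |t| := by
        by_contra h
        exact ht (abs_le.1 (not_le.1 h).le)
      have : |t| ^ (-s) ≤ 1 := Real.rpow_le_one_of_one_le_of_nonpos this (by linarith)
      nlinarith [norm_nonneg (f t)]

theorem integral_compIncrement_eq (μ ν : Measure ℝ) [IsProbabilityMeasure μ] [SFinite ν]
    (hν : Integrable (fun u => min 1 (u ^ 2)) ν) (γ : ℝ)
    (hμ : ∀ t, charFun μ t = levyExp γ (fun t => ∫ u, compExp t u ∂ν) t)
    (f : 𝓢(ℝ, ℂ)) {s : ℝ} (hs0 : 0 ≤ s) (hs1 : s < 1) {δ : ℕ → ℝ}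
    (hδ : Tendsto δ atTop (𝓝 0))
    (hτ : Tendsto (fun n : ℕ => ν.real {u : ℝ | (n : ℝ) + 1 < |u|}) atTop (𝓝 0))
    (hK : ∀ (n : ℕ) (t : ℝ), t ≠ 0 →
      ‖∫ u in {u : ℝ | 1 < |u| ∧ |u| ≤ (n : ℝ) + 1}, osc t u * u ∂ν‖ *
        ν.real {u : ℝ | (n : ℝ) + 1 < |u|} ≤ δ n * |t| ^ (-s))
    {C : ℝ} (hint : ∀ x, Integrable (compIncrement (oscIntegral f) x) ν)
    (hC : ∀ x, ∫ u, ‖compIncrement (oscIntegral f) x u‖ ∂ν ≤ C) :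
    ∫ x, ∫ u, compIncrement (oscIntegral f) x u ∂ν ∂μ =
      ∫ x : ℝ, (x - γ) * oscIntegral f x ∂μ := by
  set R : ℕ → ℝ := fun n => (n : ℝ) + 1 with hR
  have hR1 : ∀ n, 1 ≤ R n := fun n => by simp [hR]
  have hR0 : ∀ n, 0 ≤ R n := fun n => zero_le_one.trans (hR1 n)
  set τ : ℕ → ℝ := fun n => ν.real {u : ℝ | R n < |u|} with hτdef
  set φ : ℕ → ℝ → ℂ := fun n => levyExp γ (truncExponent ν (R n)) with hφ
  set k : ℕ → ℝ → ℂ := fun n => truncKernel ν (R n) with hk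
  set M := ∫ u, min 1 (u ^ 2) ∂ν with hM
  have hdiff : ∀ n t, ‖φ n t - charFun μ t‖ ≤ 2 * τ n := fun n t => by
    rw [hμ]
    exact (norm_levyExp_sub_le (re_integral_compExp_nonpos _ t)
      (re_integral_compExp_nonpos _ t)).trans (norm_truncExponent_sub_le hν (hR1 n) t)
  have hφc : ∀ n, Continuous (φ n) := fun n => continuous_iff_continuousAt.2 fun t =>
    (hasDerivAt_levyExp hν (hR0 n) γ t).continuousAt
  have hφb : ∀ n t, ‖φ n t‖ ≤ 1 := fun n t =>
    norm_levyExp_le_one (re_integral_compExp_nonpos _ t)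
  have hmχ : Measurable (charFun μ) := measurable_charFun
  have hφlim : ∀ t, Tendsto (fun n => φ n t) atTop (𝓝 (charFun μ t)) := fun t => by
    rw [tendsto_iff_norm_sub_tendsto_zero]
    refine squeeze_zero (fun _ => norm_nonneg _) (fun n => hdiff n t) ?_
    simpa using hτ.const_mul 2
  have hlim : ∀ F : ℝ → ℂ, Integrable F →
      Tendsto (fun n => ∫ t, F t * φ n t) atTop (𝓝 (∫ t, F t * charFun μ t)) := fun F hF =>
    tendsto_integral_of_dominated_convergence (fun t => ‖F t‖)
      (fun n => hF.aestronglyMeasurable.mul (hφc n).aestronglyMeasurable) hF.norm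
      (fun n => ae_of_all _ fun t => by
        rw [norm_mul]; exact mul_le_of_le_one_right (norm_nonneg _) (hφb n t))
      (ae_of_all _ fun t => (hφlim t).const_mul _)
  have hIb : ∀ F : ℝ → ℂ, Integrable F → Integrable (fun t => F t * charFun μ t) := fun F hF =>
    hF.mul_bdd (c := 1) hmχ.aestronglyMeasurable (ae_of_all _ fun t => norm_charFun_le_one t)
  have hIφ : ∀ n, ∀ F : ℝ → ℂ, Integrable F → Integrable (fun t => F t * φ n t) := fun n F hF =>
    hF.mul_bdd (c := 1) (hφc n).aestronglyMeasurable (ae_of_all _ (hφb n))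
  have hk_int : ∀ n, Integrable fun t => f t * k n t := fun n =>
    integrable_mul_truncKernel hν f (hR0 n)
  have herr : Tendsto (fun n => ∫ t, f t * k n t * (φ n t - charFun μ t)) atTop (𝓝 0) := by
    have hbd : ∀ n, ‖∫ t, f t * k n t * (φ n t - charFun μ t)‖ ≤
        2 * (M * τ n) * (∫ t, |t| * ‖f t‖) + 2 * δ n * ∫ t, |t| ^ (-s) * ‖f t‖ := fun n => by
      have i1 := f.integrable_abs_mul.const_mul (2 * (M * τ n))
      have i2 := (integrable_abs_rpow_mul f hs0 hs1).const_mul (2 * δ n)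
      rw [← integral_const_mul, ← integral_const_mul, ← integral_add i1 i2]
      refine norm_integral_le_of_norm_le (i1.add i2) ?_
      filter_upwards [compl_mem_ae_iff.2 (measure_singleton (0 : ℝ))] with t ht
      have ht0 : t ≠ 0 := ht
      have h1 := hK n t ht0
      have h2 := norm_truncKernel_le_add hν (hR1 n) t
      have hτ0 : 0 ≤ τ n := measureReal_nonneg
      rw [norm_mul, norm_mul]
      calc ‖f t‖ * ‖k n t‖ * ‖φ n t - charFun μ t‖
          ≤ ‖f t‖ * (|t| * M + ‖∫ u in {u : ℝ | 1 < |u| ∧ |u| ≤ R n}, osc t u * u ∂ν‖) *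
            (2 * τ n) := by gcongr; exact hdiff n t
        _ = 2 * (M * τ n) * (|t| * ‖f t‖) + 2 * ‖f t‖ *
            (‖∫ u in {u : ℝ | 1 < |u| ∧ |u| ≤ R n}, osc t u * u ∂ν‖ * τ n) := by ring
        _ ≤ 2 * (M * τ n) * (|t| * ‖f t‖) + 2 * ‖f t‖ * (δ n * |t| ^ (-s)) := by gcongr
        _ = _ := by ring
    refine squeeze_zero_norm hbd ?_
    have := (((hτ.const_mul M).const_mul 2).mul_const (∫ t, |t| * ‖f t‖)).add
      ((hδ.const_mul 2).mul_const (∫ t, |t| ^ (-s) * ‖f t‖))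
    simpa using this
  have hkey : Tendsto (fun n => ∫ t, f t * k n t * charFun μ t) atTop
      (𝓝 (Complex.I * (∫ t, deriv f t * charFun μ t) - γ * ∫ t, f t * charFun μ t)) := by
    have h := (((hlim _ f.integrable_deriv).const_mul Complex.I).sub
      ((hlim _ f.integrable).const_mul (γ : ℂ))).sub herr
    rw [sub_zero] at h
    refine h.congr fun n => ?_
    have e1 := integral_deriv_mul_levyExp hν f (hR0 n) γ
    have e2 : ∫ t, f t * k n t * (φ n t - charFun μ t) =
        (∫ t, f t * k n t * φ n t) - ∫ t, f t * k n t * charFun μ t := by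
      rw [← integral_sub (hIφ n _ (hk_int n)) (hIb _ (hk_int n))]
      simp only [mul_sub]
    rw [e2]
    linear_combination e1
  have hh : ∀ n, ∫ x, ∫ u in {u : ℝ | |u| ≤ R n}, compIncrement (oscIntegral f) x u ∂ν ∂μ =
      ∫ t, f t * k n t * charFun μ t := fun n => by
    rw [← integral_oscIntegral (hk_int n) μ]
    exact integral_congr_ae (ae_of_all _ fun x =>
      setIntegral_compIncrement_oscIntegral hν f (hR0 n) x)
  have hhlim : Tendsto (fun n => ∫ x, ∫ u in {u : ℝ | |u| ≤ R n},
      compIncrement (oscIntegral f) x u ∂ν ∂μ) atTop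
      (𝓝 (∫ x, ∫ u, compIncrement (oscIntegral f) x u ∂ν ∂μ)) := by
    refine tendsto_integral_of_dominated_convergence (fun _ => C) (fun n => ?_)
      (integrable_const C) (fun n => ae_of_all _ fun x => ?_) (ae_of_all _ fun x => ?_)
    · refine (continuous_oscIntegral (hk_int n)).aestronglyMeasurable.congr (ae_of_all _ fun x => ?_)
      exact (setIntegral_compIncrement_oscIntegral hν f (hR0 n) x).symm
    · refine (norm_integral_le_integral_norm _).trans (le_trans ?_ (hC x))
      exact setIntegral_le_integral (hint x).norm (ae_of_all _ fun _ => norm_nonneg _)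
    · have hU : ⋃ n, {u : ℝ | |u| ≤ R n} = Set.univ := by
        refine Set.eq_univ_of_forall fun u => Set.mem_iUnion.2 ?_
        obtain ⟨n, hn⟩ := exists_nat_ge |u|
        exact ⟨n, hn.trans (by simp [hR])⟩
      have hmono : Monotone fun n => {u : ℝ | |u| ≤ R n} := fun m n hmn u (hu : |u| ≤ R m) => by
        refine hu.trans ?_
        simp only [hR]; gcongr
      have := tendsto_setIntegral_of_monotone (μ := ν) (f := compIncrement (oscIntegral f) x)
        (fun n => measurableSet_abs_le (R n)) hmono (by rw [hU]; exact (hint x).integrableOn)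
      rwa [hU, setIntegral_univ] at this
  simp only [hh] at hhlim
  rw [tendsto_nhds_unique hhlim hkey]
  have e : ∀ x : ℝ, ((x : ℂ) - γ) * oscIntegral f x =
      Complex.I * oscIntegral (deriv f) x - γ * oscIntegral f x := fun x => by
    rw [sub_mul, mul_oscIntegral]
  simp only [e]
  rw [integral_sub ((integrable_oscIntegral f.integrable_deriv μ).const_mul _)
    ((integrable_oscIntegral f.integrable μ).const_mul _), integral_const_mul, integral_const_mul,
    integral_oscIntegral f.integrable_deriv, integral_oscIntegral f.integrable]

section Stable

variable {α m₁ m₂ : ℝ}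

lemma stableLevyDensity_of_pos (α m₁ m₂ : ℝ) {u : ℝ} (hu : 0 < u) :
    stableLevyDensity α m₁ m₂ u = m₁ * u ^ (-(α + 1)) := by
  rw [stableLevyDensity, if_pos hu, Real.rpow_neg hu.le, div_eq_mul_inv]

lemma stableLevyDensity_neg_of_pos (α m₁ m₂ : ℝ) {u : ℝ} (hu : 0 < u) :
    stableLevyDensity α m₁ m₂ (-u) = m₂ * u ^ (-(α + 1)) := by
  rw [stableLevyDensity, if_neg (by linarith), if_pos (by linarith), abs_neg, abs_of_pos hu,
    Real.rpow_neg hu.le, div_eq_mul_inv]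

lemma stableLevyDensity_nonneg (h₁ : 0 ≤ m₁) (h₂ : 0 ≤ m₂) (u : ℝ) :
    0 ≤ stableLevyDensity α m₁ m₂ u := by
  unfold stableLevyDensity
  split_ifs with h
  · exact div_nonneg h₁ (Real.rpow_nonneg h.le _)
  · positivity
  · exact le_rfl

lemma stableLevyDensity_le (h₁ : 0 ≤ m₁) (h₂ : 0 ≤ m₂) (u : ℝ) :
    stableLevyDensity α m₁ m₂ u ≤ (m₁ + m₂) * |u| ^ (-(α + 1)) := by
  have hp : 0 ≤ |u| ^ (-(α + 1)) := by positivity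
  rcases lt_trichotomy u 0 with h | h | h
  · have := stableLevyDensity_neg_of_pos α m₁ m₂ (neg_pos.2 h)
    rw [neg_neg] at this
    rw [this, abs_of_neg h] at *
    nlinarith
  · rw [stableLevyDensity, if_neg h.not_gt, if_neg h.not_lt]
    positivity
  · rw [stableLevyDensity_of_pos _ _ _ h, abs_of_pos h] at *
    nlinarith

@[fun_prop]
lemma measurable_stableLevyDensity : Measurable (stableLevyDensity α m₁ m₂) := by
  unfold stableLevyDensity
  refine Measurable.ite measurableSet_Ioi ?_ (Measurable.ite measurableSet_Iio ?_ ?_)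
  all_goals fun_prop

instance : SFinite (stableLevyMeasure α m₁ m₂) := by
  unfold stableLevyMeasure; infer_instance

variable {E : Type*} [NormedAddCommGroup E] [NormedSpace ℝ E]

lemma integrable_stableLevyMeasure_iff (h₁ : 0 ≤ m₁) (h₂ : 0 ≤ m₂) {F : ℝ → E} :
    Integrable F (stableLevyMeasure α m₁ m₂) ↔
      Integrable fun u => stableLevyDensity α m₁ m₂ u • F u := by
  unfold stableLevyMeasure
  rw [integrable_withDensity_iff_integrable_smul' (by fun_prop)
    (ae_of_all _ fun u => ENNReal.ofReal_lt_top)]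
  simp only [ENNReal.toReal_ofReal (stableLevyDensity_nonneg h₁ h₂ _)]

lemma integral_stableLevyMeasure (h₁ : 0 ≤ m₁) (h₂ : 0 ≤ m₂) (F : ℝ → E) :
    ∫ u, F u ∂(stableLevyMeasure α m₁ m₂) = ∫ u, stableLevyDensity α m₁ m₂ u • F u := by
  unfold stableLevyMeasure
  rw [integral_withDensity_eq_integral_toReal_smul (by fun_prop)
    (ae_of_all _ fun u => ENNReal.ofReal_lt_top)]
  simp only [ENNReal.toReal_ofReal (stableLevyDensity_nonneg h₁ h₂ _)]

lemma integral_stableLevyMeasure_eq_add (h₁ : 0 ≤ m₁) (h₂ : 0 ≤ m₂) {F : ℝ → E}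
    (hF : Integrable F (stableLevyMeasure α m₁ m₂)) :
    ∫ u, F u ∂(stableLevyMeasure α m₁ m₂) =
      m₁ • (∫ u in Set.Ioi 0, u ^ (-(α + 1)) • F u) +
        m₂ • ∫ u in Set.Ioi 0, u ^ (-(α + 1)) • F (-u) := by
  have hI := (integrable_stableLevyMeasure_iff h₁ h₂).1 hF
  rw [integral_stableLevyMeasure h₁ h₂, ← integral_add_compl measurableSet_Ioi hI, Set.compl_Ioi]
  congr 1
  · rw [← integral_smul]
    refine setIntegral_congr_fun measurableSet_Ioi fun u hu => ?_
    simp only [stableLevyDensity_of_pos _ _ _ hu, mul_smul]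
  · have := integral_comp_neg_Ioi 0 fun u => stableLevyDensity α m₁ m₂ u • F u
    rw [neg_zero] at this
    rw [← this, ← integral_smul]
    refine setIntegral_congr_fun measurableSet_Ioi fun u hu => ?_
    simp only [stableLevyDensity_neg_of_pos _ _ _ hu, mul_smul]

lemma integrable_comp_abs_of_integrableOn_Ioi {φ : ℝ → ℝ} (h : IntegrableOn φ (Set.Ioi 0)) :
    Integrable fun u => φ |u| := by
  have hpos : IntegrableOn (fun u => φ |u|) (Set.Ioi 0) :=
    h.congr_fun (fun u hu => by simp only [abs_of_pos (Set.mem_Ioi.1 hu)]) measurableSet_Ioi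
  have hneg : IntegrableOn (fun u => φ |u|) (Set.Iio 0) := by
    have := hpos.comp_neg
    simpa using this
  rw [← integrableOn_univ, ← Set.Iic_union_Ioi (a := (0 : ℝ))]
  exact ((integrableOn_Iic_iff_integrableOn_Iio).2 hneg).union hpos

lemma integrable_stableLevyMeasure_of_le (h₁ : 0 ≤ m₁) (h₂ : 0 ≤ m₂) {φ : ℝ → ℝ}
    (hφ : IntegrableOn (fun u => u ^ (-(α + 1)) * φ u) (Set.Ioi 0)) {F : ℝ → E}
    (hF : StronglyMeasurable F) (hle : ∀ u, ‖F u‖ ≤ φ |u|) :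
    Integrable F (stableLevyMeasure α m₁ m₂) := by
  rw [integrable_stableLevyMeasure_iff h₁ h₂]
  refine ((integrable_comp_abs_of_integrableOn_Ioi hφ).const_mul (m₁ + m₂)).mono'
    (measurable_stableLevyDensity.stronglyMeasurable.smul hF).aestronglyMeasurable
    (ae_of_all _ fun u => ?_)
  rw [norm_smul, Real.norm_of_nonneg (stableLevyDensity_nonneg h₁ h₂ u), ← mul_assoc]
  have := stableLevyDensity_nonneg (α := α) h₁ h₂ u
  have := stableLevyDensity_le (α := α) h₁ h₂ u
  gcongr
  exact hle u

lemma integrableOn_Ioc_rpow {r : ℝ} (hr : -1 < r) :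
    IntegrableOn (fun u : ℝ => u ^ r) (Set.Ioc 0 1) :=
  (intervalIntegral.intervalIntegrable_rpow' (a := 0) (b := 1) hr).1

lemma integrableOn_rpow_mul_min (h0 : 0 < α) (h2 : α < 2) :
    IntegrableOn (fun u : ℝ => u ^ (-(α + 1)) * min 1 (u ^ 2)) (Set.Ioi 0) := by
  rw [← Set.Ioc_union_Ioi_eq_Ioi zero_le_one]
  refine IntegrableOn.union ?_ ?_
  · refine (integrableOn_Ioc_rpow (r := 1 - α) (by linarith)).congr_fun (fun u hu => ?_)
      measurableSet_Ioc
    simp only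
    rw [min_one_sq_of_le (by rw [abs_of_pos hu.1]; exact hu.2), ← Real.rpow_natCast u 2,
      ← Real.rpow_add hu.1]
    congr 1; push_cast; ring
  · refine (integrableOn_Ioi_rpow_of_lt (a := -(α + 1)) (by linarith) one_pos).congr_fun
      (fun u hu => ?_) measurableSet_Ioi
    have hu1 : (1 : ℝ) < u := hu
    simp only
    rw [min_one_sq_of_lt (by rw [abs_of_pos (by linarith)]; exact hu1), mul_one]

lemma integrable_min_stableLevyMeasure (h0 : 0 < α) (h2 : α < 2) (h₁ : 0 ≤ m₁) (h₂ : 0 ≤ m₂) :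
    Integrable (fun u => min 1 (u ^ 2)) (stableLevyMeasure α m₁ m₂) :=
  integrable_stableLevyMeasure_of_le h₁ h₂ (integrableOn_rpow_mul_min h0 h2)
    (Measurable.stronglyMeasurable (by fun_prop)) fun u => by
      rw [sq_abs, Real.norm_of_nonneg (by positivity)]

lemma stableLevyMeasure_real_lt_abs (h0 : 0 < α) (h2 : α < 2) (h₁ : 0 ≤ m₁) (h₂ : 0 ≤ m₂)
    {R : ℝ} (hR : 1 ≤ R) :
    (stableLevyMeasure α m₁ m₂).real {u | R < |u|} = (m₁ + m₂) / α * R ^ (-α) := by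
  have hR0 : 0 < R := by linarith
  have hm := measurableSet_lt_abs R
  have hfin := measure_lt_abs_lt_top (integrable_min_stableLevyMeasure h0 h2 h₁ h₂) hR
  have hI : Integrable ({u : ℝ | R < |u|}.indicator fun _ => (1 : ℝ))
      (stableLevyMeasure α m₁ m₂) :=
    (integrable_indicator_iff hm).2 (integrableOn_const hfin.ne)
  have e : ∀ c : ℝ → ℝ, (∀ u, 0 < u → |c u| = u) → ∫ u in Set.Ioi 0, u ^ (-(α + 1)) •
      ({u : ℝ | R < |u|}.indicator (fun _ => (1 : ℝ)) (c u)) = R ^ (-α) / α := fun c hc => by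
    have : ∫ u in Set.Ioi 0, u ^ (-(α + 1)) •
        ({u : ℝ | R < |u|}.indicator (fun _ => (1 : ℝ)) (c u)) =
        ∫ u in Set.Ioi 0, (Set.Ioi R).indicator (fun u => u ^ (-(α + 1))) u := by
      refine setIntegral_congr_fun measurableSet_Ioi fun u hu => ?_
      simp only [Set.indicator_apply, Set.mem_ofPred_eq, hc u hu, Set.mem_Ioi]
      split_ifs <;> simp
    rw [this, setIntegral_indicator measurableSet_Ioi,
      Set.inter_eq_self_of_subset_right (Set.Ioi_subset_Ioi hR0.le),
      integral_Ioi_rpow_of_lt (by linarith) hR0]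
    rw [show -(α + 1) + 1 = -α by ring, neg_div_neg_eq]
  have h := integral_stableLevyMeasure_eq_add h₁ h₂ hI
  rw [integral_indicator_const _ hm, e (fun u => u) (fun u hu => abs_of_pos hu),
    e (fun u => -u) (fun u hu => by rw [abs_neg, abs_of_pos hu])] at h
  simp only [smul_eq_mul, mul_one] at h
  rw [h]; ring

/-- Oscillatory bound for the truncated power integral. -/
lemma norm_integral_rpow_mul_osc_le (h0 : 0 < α) {R t : ℝ} (hR : 1 ≤ R) (ht : t ≠ 0) :
    ‖∫ u in (1 : ℝ)..R, ((u ^ (-α) : ℝ) : ℂ) * osc t u‖ ≤ 2 / |t| := by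
  have hpos : ∀ u ∈ Set.uIcc 1 R, 0 < u := fun u hu => by
    rw [Set.uIcc_of_le hR] at hu; linarith [hu.1]
  have htc : (t : ℂ) ≠ 0 := by exact_mod_cast ht
  have hd : ∀ u ∈ Set.uIcc 1 R, HasDerivAt (fun u : ℝ => ((u ^ (-α) : ℝ) : ℂ))
      (((-α * u ^ (-α - 1) : ℝ)) : ℂ) u := fun u hu =>
    (Real.hasDerivAt_rpow_const (Or.inl (hpos u hu).ne')).ofReal_comp
  have hv : ∀ u ∈ Set.uIcc 1 R, HasDerivAt (fun u : ℝ => osc t u / (Complex.I * t))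
      (osc t u) u := fun u _ => by
    have h := (hasDerivAt_osc u t).div_const (Complex.I * t)
    have e : Complex.I * ↑t * osc u t / (Complex.I * ↑t) = osc t u := by
      rw [osc_comm u t]; field_simp [Complex.I_ne_zero]
    rw [e] at h
    simpa only [osc_comm _ t] using h
  have hc' : ContinuousOn (fun u : ℝ => -α * u ^ (-α - 1)) (Set.uIcc 1 R) :=
    continuousOn_const.mul (continuousOn_id.rpow_const fun u hu => Or.inl (hpos u hu).ne')
  have hparts := intervalIntegral.integral_mul_deriv_eq_deriv_mul hd hv
    (Complex.continuous_ofReal.comp_continuousOn hc').intervalIntegrable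
    (continuous_osc t).continuousOn.intervalIntegrable
  have hn : ∀ u, ‖osc t u / (Complex.I * t)‖ = 1 / |t| := fun u => by
    rw [norm_div, norm_osc]; simp
  have hR0 : 0 < R := by linarith
  have hi : ∫ u in (1 : ℝ)..R, α * u ^ (-α - 1) = 1 - R ^ (-α) := by
    rw [intervalIntegral.integral_const_mul, integral_rpow (Or.inr ⟨by linarith, fun h =>
      lt_irrefl _ (hpos _ h)⟩)]
    rw [Real.one_rpow, sub_add_cancel]
    field_simp
    ring
  have hb : ‖∫ u in (1 : ℝ)..R, (((-α * u ^ (-α - 1) : ℝ)) : ℂ) * (osc t u / (Complex.I * t))‖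
      ≤ (1 - R ^ (-α)) * (1 / |t|) := by
    rw [← hi, ← intervalIntegral.integral_mul_const]
    refine intervalIntegral.norm_integral_le_of_norm_le hR (ae_of_all _ fun u hu => ?_) ?_
    · have hu0 : 0 < u := by linarith [hu.1]
      rw [norm_mul, hn, Complex.norm_real, Real.norm_eq_abs, neg_mul, abs_neg,
        abs_of_nonneg (by positivity)]
    · refine ContinuousOn.intervalIntegrable ?_
      exact (continuousOn_const.mul
        (continuousOn_id.rpow_const fun u hu => Or.inl (hpos u hu).ne')).mul continuousOn_const
  rw [hparts]
  have h1 : ‖((R ^ (-α) : ℝ) : ℂ) * (osc t R / (Complex.I * t))‖ = R ^ (-α) * (1 / |t|) := by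
    rw [norm_mul, hn, Complex.norm_real, Real.norm_of_nonneg (by positivity)]
  have h2 : ‖(((1 : ℝ) ^ (-α) : ℝ) : ℂ) * (osc t 1 / (Complex.I * t))‖ = 1 / |t| := by
    rw [norm_mul, hn, Complex.norm_real, Real.one_rpow, norm_one, one_mul]
  refine (norm_sub_le _ _).trans ((add_le_add (norm_sub_le _ _) hb).trans_eq ?_)
  rw [h1, h2]; ring

lemma norm_integral_rpow_mul_osc_le_self (h0 : 0 < α) {R : ℝ} (hR : 1 ≤ R) (t : ℝ) :
    ‖∫ u in (1 : ℝ)..R, ((u ^ (-α) : ℝ) : ℂ) * osc t u‖ ≤ R := by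
  have h := intervalIntegral.norm_integral_le_of_norm_le_const (a := 1) (b := R) (C := 1)
    (f := fun u => ((u ^ (-α) : ℝ) : ℂ) * osc t u) fun u hu => by
      rw [Set.uIoc_of_le hR] at hu
      have hu0 : 0 < u := by linarith [hu.1]
      rw [norm_mul, norm_osc, mul_one, Complex.norm_real, Real.norm_of_nonneg (by positivity)]
      exact Real.rpow_le_one_of_one_le_of_nonpos hu.1.le (by linarith)
  rw [one_mul, abs_of_nonneg (by linarith)] at h
  linarith

lemma norm_integral_rpow_mul_osc_le_interp (h0 : 0 < α) (h2 : α < 2) {R t : ℝ} (hR : 1 ≤ R)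
    (ht : t ≠ 0) :
    ‖∫ u in (1 : ℝ)..R, ((u ^ (-α) : ℝ) : ℂ) * osc t u‖ ≤
      2 * R ^ (α / 2) * |t| ^ (-(1 - α / 2)) := by
  set J := ‖∫ u in (1 : ℝ)..R, ((u ^ (-α) : ℝ) : ℂ) * osc t u‖
  have hJ : 0 ≤ J := norm_nonneg _
  have ht0 : 0 < |t| := abs_pos.2 ht
  have e : J = J ^ (α / 2) * J ^ (1 - α / 2) := by
    rw [← Real.rpow_add_of_nonneg hJ (by linarith) (by linarith)]; simp
  have h2' : (2 : ℝ) ^ (1 - α / 2) ≤ 2 := by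
    calc (2 : ℝ) ^ (1 - α / 2) ≤ 2 ^ (1 : ℝ) :=
          Real.rpow_le_rpow_of_exponent_le (by norm_num) (by linarith)
      _ = 2 := by simp
  calc J = J ^ (α / 2) * J ^ (1 - α / 2) := e
    _ ≤ R ^ (α / 2) * (2 / |t|) ^ (1 - α / 2) := by
        have := norm_integral_rpow_mul_osc_le_self h0 hR t
        have := norm_integral_rpow_mul_osc_le h0 hR ht
        have : 0 ≤ 1 - α / 2 := by linarith
        gcongr
    _ = 2 ^ (1 - α / 2) * R ^ (α / 2) * |t| ^ (-(1 - α / 2)) := by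
        rw [Real.div_rpow (by norm_num) ht0.le, Real.rpow_neg ht0.le]; ring
    _ ≤ _ := by gcongr

lemma norm_setIntegral_osc_mul_le (h0 : 0 < α) (h2 : α < 2) (h₁ : 0 ≤ m₁) (h₂ : 0 ≤ m₂)
    {R t : ℝ} (hR : 1 ≤ R) (ht : t ≠ 0) :
    ‖∫ u in {u : ℝ | 1 < |u| ∧ |u| ≤ R}, osc t u * u ∂(stableLevyMeasure α m₁ m₂)‖ ≤
      (m₁ + m₂) * (2 * R ^ (α / 2) * |t| ^ (-(1 - α / 2))) := by
  have hm : MeasurableSet {u : ℝ | 1 < |u| ∧ |u| ≤ R} :=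
    (measurableSet_lt_abs 1).inter (measurableSet_abs_le R)
  have hν := integrable_min_stableLevyMeasure h0 h2 h₁ h₂
  have hfin : stableLevyMeasure α m₁ m₂ {u : ℝ | 1 < |u| ∧ |u| ≤ R} ≠ ⊤ :=
    ((measure_mono fun u hu => hu.1).trans_lt (measure_lt_abs_lt_top hν le_rfl)).ne
  have hI : IntegrableOn (fun u => osc t u * u) {u : ℝ | 1 < |u| ∧ |u| ≤ R}
      (stableLevyMeasure α m₁ m₂) := by
    refine Measure.integrableOn_of_bounded (M := R) hfin
      (Measurable.aestronglyMeasurable (by fun_prop))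
      ((ae_restrict_iff' hm).2 (ae_of_all _ fun u hu => ?_))
    rw [norm_mul, norm_osc, one_mul, Complex.norm_real]
    exact hu.2
  have e1 : ∫ u in Set.Ioi 0, u ^ (-(α + 1)) •
      ({u : ℝ | 1 < |u| ∧ |u| ≤ R}.indicator (fun u => osc t u * u) u) =
      ∫ u in (1 : ℝ)..R, ((u ^ (-α) : ℝ) : ℂ) * osc t u := by
    have : ∫ u in Set.Ioi 0, u ^ (-(α + 1)) •
        ({u : ℝ | 1 < |u| ∧ |u| ≤ R}.indicator (fun u => osc t u * u) u) =
        ∫ u in Set.Ioi 0, (Set.Ioc 1 R).indicator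
          (fun u => ((u ^ (-α) : ℝ) : ℂ) * osc t u) u := by
      refine setIntegral_congr_fun measurableSet_Ioi fun u hu => ?_
      have hu0 : 0 < u := hu
      simp only [Set.indicator_apply, Set.mem_ofPred_eq, abs_of_pos hu0, Set.mem_Ioc]
      split_ifs
      · have : u ^ (-α) = u ^ (-(α + 1)) * u := by
          rw [← Real.rpow_add_one hu0.ne']; congr 1; ring
        rw [this, Complex.real_smul]; push_cast; ring
      · simp
    rw [this, setIntegral_indicator measurableSet_Ioc, Set.inter_eq_self_of_subset_right
      (Set.Ioc_subset_Ioi_self.trans (Set.Ioi_subset_Ioi zero_le_one)),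
      intervalIntegral.integral_of_le hR]
  have e2 : ∫ u in Set.Ioi 0, u ^ (-(α + 1)) •
      ({u : ℝ | 1 < |u| ∧ |u| ≤ R}.indicator (fun u => osc t u * u) (-u)) =
      -∫ u in (1 : ℝ)..R, ((u ^ (-α) : ℝ) : ℂ) * osc (-t) u := by
    have : ∫ u in Set.Ioi 0, u ^ (-(α + 1)) •
        ({u : ℝ | 1 < |u| ∧ |u| ≤ R}.indicator (fun u => osc t u * u) (-u)) =
        ∫ u in Set.Ioi 0, (Set.Ioc 1 R).indicator
          (fun u => -(((u ^ (-α) : ℝ) : ℂ) * osc (-t) u)) u := by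
      refine setIntegral_congr_fun measurableSet_Ioi fun u hu => ?_
      have hu0 : 0 < u := hu
      simp only [Set.indicator_apply, Set.mem_ofPred_eq, abs_neg, abs_of_pos hu0, Set.mem_Ioc]
      split_ifs
      · have : u ^ (-α) = u ^ (-(α + 1)) * u := by
          rw [← Real.rpow_add_one hu0.ne']; congr 1; ring
        have h' : osc t (-u) = osc (-t) u := by simp [osc_eq]
        rw [this, Complex.real_smul, h']; push_cast; ring
      · simp
    rw [this, setIntegral_indicator measurableSet_Ioc, Set.inter_eq_self_of_subset_right
      (Set.Ioc_subset_Ioi_self.trans (Set.Ioi_subset_Ioi zero_le_one)),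
      intervalIntegral.integral_of_le hR, integral_neg]
  rw [← integral_indicator hm,
    integral_stableLevyMeasure_eq_add h₁ h₂ ((integrable_indicator_iff hm).2 hI), e1, e2]
  refine (norm_add_le _ _).trans ?_
  rw [norm_smul, norm_smul, norm_neg, Real.norm_of_nonneg h₁, Real.norm_of_nonneg h₂, add_mul]
  have b1 := norm_integral_rpow_mul_osc_le_interp h0 h2 hR ht
  have b2 := norm_integral_rpow_mul_osc_le_interp h0 h2 hR (neg_ne_zero.2 ht)
  rw [abs_neg] at b2
  gcongr

end Stable

section Stable

variable {α m₁ m₂ : ℝ}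

lemma norm_oscIntegral_add_sub_le (f : 𝓢(ℝ, ℂ)) (x u : ℝ) :
    ‖oscIntegral f (x + u) - oscIntegral f x‖ ≤ (∫ t, |t| * ‖f t‖) * |u| := by
  unfold oscIntegral
  rw [← integral_sub (integrable_mul_osc f.integrable _) (integrable_mul_osc f.integrable _),
    ← integral_mul_const]
  refine norm_integral_le_of_norm_le (f.integrable_abs_mul.mul_const _) (ae_of_all _ fun t => ?_)
  have : f t * osc t (x + u) - f t * osc t x = f t * osc t x * (osc t u - 1) := by
    rw [osc_add]; ring
  rw [this, norm_mul, norm_mul, norm_osc, mul_one]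
  nlinarith [norm_osc_sub_one_le t u, norm_nonneg (f t)]

/-- The contribution of the large jumps to the norm of the compensated increment. -/
def largeJumpNorm (G : ℝ → ℂ) (x : ℝ) : ℝ → ℝ :=
  {u : ℝ | 1 < |u|}.indicator fun u => ‖G (x + u)‖ * |u|

lemma density_mul_largeJumpNorm_le (h0 : 0 < α) (h₁ : 0 ≤ m₁) (h₂ : 0 ≤ m₂) (G : ℝ → ℂ)
    (x u : ℝ) : stableLevyDensity α m₁ m₂ u * largeJumpNorm G x u ≤ (m₁ + m₂) * ‖G (x + u)‖ := by
  by_cases hu : 1 < |u|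
  · rw [largeJumpNorm, Set.indicator_of_mem (show u ∈ {u : ℝ | 1 < |u|} from hu)]
    have hu0 : 0 < |u| := by linarith
    have h := stableLevyDensity_le (α := α) h₁ h₂ u
    have hle : |u| ^ (-(α + 1)) * |u| ≤ 1 := by
      rw [← Real.rpow_add_one hu0.ne']
      exact Real.rpow_le_one_of_one_le_of_nonpos hu.le (by linarith)
    calc stableLevyDensity α m₁ m₂ u * (‖G (x + u)‖ * |u|)
        ≤ (m₁ + m₂) * |u| ^ (-(α + 1)) * (‖G (x + u)‖ * |u|) := by gcongr
      _ = (m₁ + m₂) * ‖G (x + u)‖ * (|u| ^ (-(α + 1)) * |u|) := by ring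
      _ ≤ (m₁ + m₂) * ‖G (x + u)‖ * 1 := by gcongr
      _ = _ := mul_one _
  · rw [largeJumpNorm, Set.indicator_of_notMem (show u ∉ {u : ℝ | 1 < |u|} from hu), mul_zero]
    positivity

lemma largeJumpNorm_nonneg (G : ℝ → ℂ) (x u : ℝ) : 0 ≤ largeJumpNorm G x u :=
  Set.indicator_nonneg (fun _ _ => by positivity) u

lemma integrable_density_mul_largeJumpNorm (h0 : 0 < α) (h₁ : 0 ≤ m₁) (h₂ : 0 ≤ m₂)
    {G : ℝ → ℂ} (hc : Continuous G) (hG : Integrable G) (x : ℝ) :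
    Integrable fun u => stableLevyDensity α m₁ m₂ u * largeJumpNorm G x u := by
  refine ((hG.comp_add_left x).norm.const_mul (m₁ + m₂)).mono' ?_ (ae_of_all _ fun u => ?_)
  · refine (measurable_stableLevyDensity.mul (Measurable.indicator ?_
      (measurableSet_lt_abs 1))).aestronglyMeasurable
    have := hc.measurable
    fun_prop
  · rw [Real.norm_of_nonneg (mul_nonneg (stableLevyDensity_nonneg h₁ h₂ u)
      (largeJumpNorm_nonneg G x u))]
    exact density_mul_largeJumpNorm_le h0 h₁ h₂ G x u

lemma norm_compIncrement_le {G : ℝ → ℂ} {L : ℝ} (hL0 : 0 ≤ L)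
    (hL : ∀ x u, ‖G (x + u) - G x‖ ≤ L * |u|) (x u : ℝ) :
    ‖compIncrement G x u‖ ≤ L * min 1 (u ^ 2) + largeJumpNorm G x u := by
  unfold compIncrement largeJumpNorm
  rw [norm_mul, Complex.norm_real, Real.norm_eq_abs]
  rcases le_or_gt |u| 1 with h | h
  · rw [Set.indicator_of_notMem (by simpa using h), smallJump_of_le h, min_one_sq_of_le h,
      ← sq_abs u, Complex.ofReal_one, mul_one]
    nlinarith [hL x u, abs_nonneg u]
  · rw [Set.indicator_of_mem (by simpa using h), smallJump_of_lt h, min_one_sq_of_lt h,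
      Complex.ofReal_zero, mul_zero, sub_zero]
    linarith

lemma integrable_compIncrement_and_integral_norm_le (h0 : 0 < α) (h2 : α < 2) (h₁ : 0 ≤ m₁)
    (h₂ : 0 ≤ m₂) {G : ℝ → ℂ} (hc : Continuous G) (hG : Integrable G) {L : ℝ} (hL0 : 0 ≤ L)
    (hL : ∀ x u, ‖G (x + u) - G x‖ ≤ L * |u|) (x : ℝ) :
    Integrable (compIncrement G x) (stableLevyMeasure α m₁ m₂) ∧
    ∫ u, ‖compIncrement G x u‖ ∂(stableLevyMeasure α m₁ m₂) ≤
      L * (∫ u, min 1 (u ^ 2) ∂(stableLevyMeasure α m₁ m₂)) + (m₁ + m₂) * ∫ u, ‖G u‖ := by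
  have i1 := (integrable_min_stableLevyMeasure h0 h2 h₁ h₂).const_mul L
  have i2' := integrable_density_mul_largeJumpNorm h0 h₁ h₂ hc hG x
  have i2 : Integrable (largeJumpNorm G x) (stableLevyMeasure α m₁ m₂) :=
    (integrable_stableLevyMeasure_iff h₁ h₂).2 i2'
  have hle := norm_compIncrement_le hL0 hL x
  have hm : Measurable (compIncrement G x) := by
    have := hc.measurable
    unfold compIncrement
    fun_prop
  have i3 : Integrable (compIncrement G x) (stableLevyMeasure α m₁ m₂) :=
    (i1.add i2).mono' hm.aestronglyMeasurable (ae_of_all _ hle)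
  refine ⟨i3, (integral_mono i3.norm (i1.add i2) hle).trans ?_⟩
  simp only [Pi.add_apply]
  rw [integral_add i1 i2, integral_const_mul]
  gcongr
  rw [integral_stableLevyMeasure h₁ h₂, ← integral_add_left_eq_self (fun u => ‖G u‖) x,
    ← integral_const_mul]
  exact integral_mono i2' ((hG.comp_add_left x).norm.const_mul _) fun u =>
    density_mul_largeJumpNorm_le h0 h₁ h₂ G x u

/-- The integrand comparing the two compensators of the Lévy-Khintchine exponent. -/
def driftIntegrand (u : ℝ) : ℝ := u * (smallJump u - 1 / (1 + u ^ 2))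

lemma abs_driftIntegrand_le (u : ℝ) : |driftIntegrand u| ≤ min 1 (u ^ 2) := by
  unfold driftIntegrand
  have hp : 0 < 1 + u ^ 2 := by positivity
  rcases le_or_gt |u| 1 with h | h
  · rw [smallJump_of_le h, min_one_sq_of_le h, abs_mul]
    have e : (1 : ℝ) - 1 / (1 + u ^ 2) = u ^ 2 / (1 + u ^ 2) := by field_simp; ring
    rw [e, abs_of_nonneg (a := u ^ 2 / (1 + u ^ 2)) (by positivity)]
    have : u ^ 2 / (1 + u ^ 2) ≤ u ^ 2 := div_le_self (by positivity) (by nlinarith)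
    have h0 : 0 ≤ u ^ 2 / (1 + u ^ 2) := by positivity
    nlinarith [abs_nonneg u]
  · rw [smallJump_of_lt h, min_one_sq_of_lt h, zero_sub, mul_neg, abs_neg, mul_one_div, abs_div,
      abs_of_pos hp, div_le_one hp, ← sq_abs]
    nlinarith [sq_nonneg (|u| - 1)]

@[fun_prop]
lemma measurable_driftIntegrand : Measurable driftIntegrand := by
  unfold driftIntegrand; fun_prop

lemma integrable_driftIntegrand {ν : Measure ℝ} (hν : Integrable (fun u => min 1 (u ^ 2)) ν) :
    Integrable driftIntegrand ν :=
  hν.mono' measurable_driftIntegrand.aestronglyMeasurable (ae_of_all _ abs_driftIntegrand_le)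

lemma levyExp_drift {ν : Measure ℝ} (hν : Integrable (fun u => min 1 (u ^ 2)) ν) (β t : ℝ) :
    Complex.exp (Complex.I * t * β + ∫ u : ℝ, (Complex.exp (Complex.I * t * u) - 1 -
      Complex.I * t * u / (1 + (u : ℂ) ^ 2)) ∂ν) =
      levyExp (β + ∫ u, driftIntegrand u ∂ν) (fun t => ∫ u, compExp t u ∂ν) t := by
  have e : ∀ u : ℝ, Complex.exp (Complex.I * t * u) - 1 -
      Complex.I * t * u / (1 + (u : ℂ) ^ 2) =
      compExp t u + Complex.I * t * (driftIntegrand u : ℂ) := fun u => by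
    simp only [compExp, driftIntegrand, osc]
    push_cast
    ring
  have hd : Integrable (fun u => Complex.I * t * (driftIntegrand u : ℂ)) ν :=
    (integrable_driftIntegrand hν).ofReal.const_mul _
  simp only [e]
  rw [integral_add (integrable_compExp hν t) hd,
    integral_const_mul, integral_complex_ofReal, levyExp]
  congr 1
  push_cast
  ring

lemma integral_stableLevyMeasure_of_odd (h₁ : 0 ≤ m₁) (h₂ : 0 ≤ m₂) {F : ℝ → ℝ}
    (hF : Integrable F (stableLevyMeasure α m₁ m₂)) (hodd : ∀ u, F (-u) = -F u) :
    ∫ u, F u ∂(stableLevyMeasure α m₁ m₂) =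
      (m₁ - m₂) * ∫ u in Set.Ioi 0, u ^ (-(α + 1)) * F u := by
  rw [integral_stableLevyMeasure_eq_add h₁ h₂ hF]
  simp only [hodd, smul_eq_mul, mul_neg, integral_neg]
  ring

lemma smallJump_neg (u : ℝ) : smallJump (-u) = smallJump u := by
  simp [smallJump, Set.indicator_apply]

lemma driftIntegrand_neg (u : ℝ) : driftIntegrand (-u) = -driftIntegrand u := by
  simp [driftIntegrand, smallJump_neg]

lemma rpow_neg_add_one_mul_self {u : ℝ} (hu : 0 < u) : u ^ (-(α + 1)) * u = (u ^ α)⁻¹ := by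
  rw [← Real.rpow_add_one hu.ne', ← Real.rpow_neg hu.le]; congr 1; ring

lemma stableGamma_of_one_le (h0 : 0 < α) (h2 : α < 2) (h1 : ¬ α < 1) (β : ℝ) (h₁ : 0 ≤ m₁)
    (h₂ : 0 ≤ m₂) : stableGamma α β m₁ m₂ =
      β + ∫ u, driftIntegrand u ∂(stableLevyMeasure α m₁ m₂) := by
  rw [stableGamma, if_neg h1, integral_stableLevyMeasure_of_odd h₁ h₂ (integrable_driftIntegrand
    (integrable_min_stableLevyMeasure h0 h2 h₁ h₂)) driftIntegrand_neg]
  have i2 : IntegrableOn (fun u : ℝ => min 1 (u ^ 2) / (u ^ α * (1 + u ^ 2))) (Set.Ioi 0) := by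
    refine (integrableOn_rpow_mul_min h0 h2).mono' (Measurable.aestronglyMeasurable (by fun_prop))
      ((ae_restrict_iff' measurableSet_Ioi).2 (ae_of_all _ fun u (hu : 0 < u) => ?_))
    have hpos : 0 < u ^ α := by positivity
    rw [Real.norm_of_nonneg (by positivity)]
    have e : min 1 (u ^ 2) / (u ^ α * (1 + u ^ 2)) =
        u ^ (-(α + 1)) * min 1 (u ^ 2) * (u / (1 + u ^ 2)) := by
      calc _ = (u ^ α)⁻¹ * min 1 (u ^ 2) / (1 + u ^ 2) := by field_simp
        _ = _ := by rw [← rpow_neg_add_one_mul_self hu]; ring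
    rw [e]
    refine mul_le_of_le_one_right (by positivity) ?_
    rw [div_le_one (by positivity)]
    nlinarith [sq_nonneg (u - 1)]
  have i1 : IntegrableOn (fun u : ℝ => (Set.Ioc 0 1).indicator
      (fun u => u ^ 2 / (u ^ α * (1 + u ^ 2))) u) (Set.Ioi 0) := by
    refine (Integrable.indicator (s := Set.Ioc 0 1) i2 measurableSet_Ioc).congr
      (ae_of_all _ fun u => ?_)
    refine Set.indicator_congr (fun u hu => ?_) |> fun h => congrFun h u
    rw [min_one_sq_of_le (by rw [abs_of_pos hu.1]; exact hu.2)]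
  have e1 : ∫ u in Set.Ioc (0 : ℝ) 1, u ^ 2 / (u ^ α * (1 + u ^ 2)) =
      ∫ u in Set.Ioi 0, (Set.Ioc 0 1).indicator (fun u => u ^ 2 / (u ^ α * (1 + u ^ 2))) u := by
    rw [setIntegral_indicator measurableSet_Ioc,
      Set.inter_eq_self_of_subset_right Set.Ioc_subset_Ioi_self]
  have e2 : ∫ u in Set.Ioi 0, u ^ (-(α + 1)) * driftIntegrand u =
      ∫ u in Set.Ioi 0, (2 * (Set.Ioc 0 1).indicator (fun u => u ^ 2 / (u ^ α * (1 + u ^ 2))) u -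
        min 1 (u ^ 2) / (u ^ α * (1 + u ^ 2))) := by
    refine setIntegral_congr_fun measurableSet_Ioi fun u (hu : 0 < u) => ?_
    have hpos : 0 < u ^ α := by positivity
    simp only [driftIntegrand]
    rw [← mul_assoc, rpow_neg_add_one_mul_self hu]
    rcases le_or_gt u 1 with h | h
    · have h' : |u| ≤ 1 := by rwa [abs_of_pos hu]
      rw [smallJump_of_le h', min_one_sq_of_le h',
        Set.indicator_of_mem (show u ∈ Set.Ioc (0 : ℝ) 1 from ⟨hu, h⟩)]
      field_simp
      ring
    · have h' : 1 < |u| := by rwa [abs_of_pos hu]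
      rw [smallJump_of_lt h', min_one_sq_of_lt h', Set.indicator_of_notMem fun hh =>
        not_le.2 h hh.2]
      field_simp
      ring
  rw [e2, integral_sub (i1.const_mul 2) i2, integral_const_mul, e1]
  ring

lemma integrable_mul_smallJump (h1 : α < 1) (h₁ : 0 ≤ m₁) (h₂ : 0 ≤ m₂) :
    Integrable (fun u => u * smallJump u) (stableLevyMeasure α m₁ m₂) := by
  refine integrable_stableLevyMeasure_of_le h₁ h₂ (φ := fun u => u * smallJump u) ?_
    (Measurable.stronglyMeasurable (by fun_prop)) fun u => ?_
  · have h : IntegrableOn (fun u : ℝ => (Set.Ioc 0 1).indicator (fun u => u ^ (-α)) u)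
        (Set.Ioi 0) :=
      ((integrableOn_Ioc_rpow (r := -α) (by linarith)).integrable_indicator
        measurableSet_Ioc).integrableOn
    refine h.congr_fun (fun u (hu : 0 < u) => ?_) measurableSet_Ioi
    simp only
    rcases le_or_gt u 1 with h | h
    · rw [smallJump_of_le (by rwa [abs_of_pos hu]),
        Set.indicator_of_mem (show u ∈ Set.Ioc (0 : ℝ) 1 from ⟨hu, h⟩), mul_one,
        rpow_neg_add_one_mul_self hu, Real.rpow_neg hu.le]
    · rw [smallJump_of_lt (by rwa [abs_of_pos hu]), Set.indicator_of_notMem fun hh =>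
        not_le.2 h hh.2]
      simp
  · have hs : smallJump |u| = smallJump u := by simp [smallJump, Set.indicator_apply]
    have hs0 : 0 ≤ smallJump u := by
      unfold smallJump; exact Set.indicator_nonneg (fun _ _ => zero_le_one) u
    rw [hs, norm_mul, Real.norm_eq_abs, Real.norm_of_nonneg hs0]

lemma stableGamma_of_lt_one (h0 : 0 < α) (h2 : α < 2) (h1 : α < 1) (β : ℝ) (h₁ : 0 ≤ m₁)
    (h₂ : 0 ≤ m₂) : stableGamma α β m₁ m₂ =
      β + (∫ u, driftIntegrand u ∂(stableLevyMeasure α m₁ m₂)) -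
        ∫ u, u * smallJump u ∂(stableLevyMeasure α m₁ m₂) := by
  have i1 := integrable_driftIntegrand (integrable_min_stableLevyMeasure h0 h2 h₁ h₂)
  have i2 := integrable_mul_smallJump h1 h₁ h₂
  have i3 : Integrable (fun u => driftIntegrand u - u * smallJump u)
    (stableLevyMeasure α m₁ m₂) := i1.sub i2
  rw [add_sub_assoc, ← integral_sub i1 i2, integral_stableLevyMeasure_of_odd h₁ h₂ i3
    (fun u => by rw [driftIntegrand_neg, smallJump_neg]; ring), stableGamma, if_pos h1,
    sub_eq_add_neg, ← mul_neg, ← integral_neg]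
  congr 2
  refine setIntegral_congr_fun measurableSet_Ioi fun u (hu : 0 < u) => ?_
  have hpos : 0 < u ^ α := by positivity
  have e : driftIntegrand u - u * smallJump u = -(u * (1 / (1 + u ^ 2))) := by
    unfold driftIntegrand; ring
  simp only [e]
  rw [mul_neg, ← mul_assoc, rpow_neg_add_one_mul_self hu]
  field_simp

end Stable

/-- A test function as a complex-valued Schwartz function. -/
def SteinTestFunction.toSchwartz {g : ℝ → ℝ} (hg : SteinTestFunction g) : 𝓢(ℝ, ℂ) where
  toFun x := (g x : ℂ)
  smooth' := Complex.ofRealCLM.contDiff.comp hg.contDiff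
  decay' k n := by
    obtain ⟨C, hC⟩ := hg.seminorm_lt_top k n
    refine ⟨C, fun x => ?_⟩
    have h := Complex.ofRealLI.norm_iteratedFDeriv_comp_left (f := g) (x := x) (n := ∞) (i := n)
      hg.contDiff.contDiffAt (by exact_mod_cast le_top)
    have e : (fun x => (g x : ℂ)) = Complex.ofRealLI ∘ g := rfl
    rw [e, h, norm_iteratedFDeriv_eq_norm_iteratedDeriv, ← norm_pow, ← norm_mul]
    exact hC x

lemma SchwartzMap.exists_oscIntegral_eq (G : 𝓢(ℝ, ℂ)) :
    ∃ f : 𝓢(ℝ, ℂ), ∀ x, oscIntegral f x = G x := by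
  have hπ : (2 * Real.pi)⁻¹ ≠ 0 := by positivity
  let A : ℝ ≃L[ℝ] ℝ := ContinuousLinearEquiv.unitsEquivAut ℝ (Units.mk0 _ hπ)
  have hA : ∀ t, A t = t * (2 * Real.pi)⁻¹ := fun t => rfl
  refine ⟨((2 * Real.pi)⁻¹ : ℂ) • SchwartzMap.compCLMOfContinuousLinearEquiv ℂ A
    (FourierTransform.fourier G), fun x => ?_⟩
  have h1 : G x = FourierTransformInv.fourierInv (FourierTransform.fourier G) x := by simp
  rw [h1, SchwartzMap.fourierInv_coe, Real.fourierInv_eq', oscIntegral]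
  have h2 := Measure.integral_comp_mul_right (fun v : ℝ => Complex.exp
    ((↑(2 * Real.pi * inner ℝ v x) : ℂ) * Complex.I) • FourierTransform.fourier G v)
    (2 * Real.pi)⁻¹
  have h3 : |((2 * Real.pi)⁻¹)⁻¹| = 2 * Real.pi := by
    rw [inv_inv, abs_of_pos (by positivity)]
  rw [h3] at h2
  have h4 : ∀ I J : ℂ, I = (2 * Real.pi) • J → J = ((2 * Real.pi)⁻¹ : ℂ) * I := fun I J h => by
    rw [h, Complex.real_smul]; push_cast
    have : (Real.pi : ℂ) ≠ 0 := by exact_mod_cast Real.pi_ne_zero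
    field_simp
  rw [h4 _ _ h2, ← integral_const_mul]
  refine integral_congr_ae (ae_of_all _ fun t => ?_)
  simp only [smul_apply, SchwartzMap.compCLMOfContinuousLinearEquiv_apply,
    Function.comp_apply, hA, smul_eq_mul]
  have h5 : osc t x = Complex.exp
      ((↑(2 * Real.pi * inner ℝ (t * (2 * Real.pi)⁻¹) x) : ℂ) * Complex.I) := by
    rw [osc_eq]
    congr 1
    have : 2 * Real.pi * inner ℝ (t * (2 * Real.pi)⁻¹) x = t * x := by
      simp; field_simp
    rw [this]; ring
  rw [h5]; ring

lemma measurable_integral_compIncrement {ν : Measure ℝ} [SFinite ν] {G : ℝ → ℂ}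
    (hc : Continuous G) : Measurable fun x => ∫ u, compIncrement G x u ∂ν := by
  have h : Measurable (Function.uncurry (compIncrement G)) := by
    have := hc.measurable
    unfold compIncrement Function.uncurry
    fun_prop
  exact (h.stronglyMeasurable.integral_prod_right (ν := ν)).measurable

section Operator

variable {α β m₁ m₂ : ℝ} {g : ℝ → ℝ}

lemma compIncrement_ofReal (g : ℝ → ℝ) (x u : ℝ) :
    compIncrement (fun y => (g y : ℂ)) x u = (((g (x + u) - g x * smallJump u) * u : ℝ) : ℂ) := by
  simp [compIncrement]

lemma integrable_ofReal_iff {ν : Measure ℝ} {F : ℝ → ℝ} :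
    Integrable (fun u => (F u : ℂ)) ν ↔ Integrable F ν :=
  ⟨fun h => h.re, fun h => h.ofReal⟩

lemma stableSteinIntegrand_of_lt_one (h1 : α < 1) (g : ℝ → ℝ) (x u : ℝ) :
    stableSteinIntegrand α g x u =
      (g (x + u) - g x * smallJump u) * u + g x * (u * smallJump u) := by
  rw [stableSteinIntegrand, if_pos h1]; ring

lemma stableSteinIntegrand_of_one_le (h1 : ¬ α < 1) (g : ℝ → ℝ) (x u : ℝ) :
    stableSteinIntegrand α g x u = (g (x + u) - g x * smallJump u) * u := by
  rw [stableSteinIntegrand, if_neg h1]; rfl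

lemma integrable_stableSteinIntegrand (h₁ : 0 ≤ m₁) (h₂ : 0 ≤ m₂) {x : ℝ}
    (hint : Integrable (compIncrement (fun y => (g y : ℂ)) x) (stableLevyMeasure α m₁ m₂)) :
    Integrable (stableSteinIntegrand α g x) (stableLevyMeasure α m₁ m₂) := by
  have hr : Integrable (fun u => (g (x + u) - g x * smallJump u) * u)
      (stableLevyMeasure α m₁ m₂) := by
    rw [← integrable_ofReal_iff]
    simpa only [← compIncrement_ofReal] using hint
  by_cases h1 : α < 1
  · refine (hr.add ((integrable_mul_smallJump h1 h₁ h₂).const_mul (g x))).congr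
      (ae_of_all _ fun u => ?_)
    rw [stableSteinIntegrand_of_lt_one h1]; rfl
  · exact hr.congr (ae_of_all _ fun u => (stableSteinIntegrand_of_one_le h1 g x u).symm)

lemma ofReal_stableSteinOperator (h0 : 0 < α) (h2 : α < 2) (h₁ : 0 ≤ m₁) (h₂ : 0 ≤ m₂) {x : ℝ}
    (hint : Integrable (compIncrement (fun y => (g y : ℂ)) x) (stableLevyMeasure α m₁ m₂)) :
    (stableSteinOperator α β m₁ m₂ g x : ℂ) =
      (x - (β + ∫ u, driftIntegrand u ∂(stableLevyMeasure α m₁ m₂) : ℝ)) * (g x : ℂ) -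
        ∫ u, compIncrement (fun y => (g y : ℂ)) x u ∂(stableLevyMeasure α m₁ m₂) := by
  have hr : Integrable (fun u => (g (x + u) - g x * smallJump u) * u)
      (stableLevyMeasure α m₁ m₂) := by
    rw [← integrable_ofReal_iff]
    simpa only [← compIncrement_ofReal] using hint
  simp only [compIncrement_ofReal]
  rw [integral_complex_ofReal, ← Complex.ofReal_sub, ← Complex.ofReal_mul, ← Complex.ofReal_sub,
    stableSteinOperator]
  congr 1
  by_cases h1 : α < 1
  · simp only [stableSteinIntegrand_of_lt_one h1]
    rw [integral_add hr ((integrable_mul_smallJump h1 h₁ h₂).const_mul (g x)),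
      integral_const_mul, stableGamma_of_lt_one h0 h2 h1 β h₁ h₂]
    ring
  · simp only [stableSteinIntegrand_of_one_le h1]
    rw [stableGamma_of_one_le h0 h2 h1 β h₁ h₂]

lemma tendsto_stableLevyMeasure_real_lt_abs (h0 : 0 < α) (h2 : α < 2) (h₁ : 0 ≤ m₁)
    (h₂ : 0 ≤ m₂) : Tendsto (fun n : ℕ =>
      (stableLevyMeasure α m₁ m₂).real {u : ℝ | (n : ℝ) + 1 < |u|}) atTop (𝓝 0) := by
  have h : Tendsto (fun n : ℕ => (m₁ + m₂) / α * ((n : ℝ) + 1) ^ (-α)) atTop (𝓝 0) := by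
    have := ((tendsto_rpow_neg_atTop h0).comp (tendsto_atTop_add_const_right atTop (1 : ℝ)
      tendsto_natCast_atTop_atTop)).const_mul ((m₁ + m₂) / α)
    simpa using this
  refine h.congr fun n => ?_
  rw [stableLevyMeasure_real_lt_abs h0 h2 h₁ h₂ (by simp)]

theorem integral_compIncrement_stable (h0 : 0 < α) (h2 : α < 2) (h₁ : 0 ≤ m₁) (h₂ : 0 ≤ m₂)
    (μ : Measure ℝ) [IsProbabilityMeasure μ] (γ : ℝ)
    (hμ : ∀ t, charFun μ t =
      levyExp γ (fun t => ∫ u, compExp t u ∂(stableLevyMeasure α m₁ m₂)) t)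
    (f : 𝓢(ℝ, ℂ)) {C : ℝ}
    (hint : ∀ x, Integrable (compIncrement (oscIntegral f) x) (stableLevyMeasure α m₁ m₂))
    (hC : ∀ x, ∫ u, ‖compIncrement (oscIntegral f) x u‖ ∂(stableLevyMeasure α m₁ m₂) ≤ C) :
    ∫ x, ∫ u, compIncrement (oscIntegral f) x u ∂(stableLevyMeasure α m₁ m₂) ∂μ =
      ∫ x : ℝ, (x - γ) * oscIntegral f x ∂μ := by
  refine integral_compIncrement_eq μ _ (integrable_min_stableLevyMeasure h0 h2 h₁ h₂) γ hμ f
    (s := 1 - α / 2) (by linarith) (by linarith)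
    (δ := fun n => 2 * (m₁ + m₂) ^ 2 / α * ((n : ℝ) + 1) ^ (-(α / 2))) ?_
    (tendsto_stableLevyMeasure_real_lt_abs h0 h2 h₁ h₂) (fun n t ht => ?_) hint hC
  · have := ((tendsto_rpow_neg_atTop (half_pos h0)).comp (tendsto_atTop_add_const_right atTop
      (1 : ℝ) tendsto_natCast_atTop_atTop)).const_mul (2 * (m₁ + m₂) ^ 2 / α)
    simpa using this
  · have hR : (1 : ℝ) ≤ (n : ℝ) + 1 := by simp
    have hR0 : (0 : ℝ) < (n : ℝ) + 1 := by positivity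
    rw [stableLevyMeasure_real_lt_abs h0 h2 h₁ h₂ hR]
    have e : ((n : ℝ) + 1) ^ (-(α / 2)) = ((n : ℝ) + 1) ^ (α / 2) * ((n : ℝ) + 1) ^ (-α) := by
      rw [← Real.rpow_add hR0]; congr 1; ring
    rw [e]
    refine (mul_le_mul_of_nonneg_right (norm_setIntegral_osc_mul_le h0 h2 h₁ h₂ hR ht)
      (by positivity)).trans_eq ?_
    ring

end Operator

end

theorem mainTheorem2 {Ω : Type*} [MeasurableSpace Ω] (P : Measure Ω) [IsProbabilityMeasure P]
    (X : Ω → ℝ) (hXm : AEMeasurable X P) (α β m₁ m₂ : ℝ)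
    (hX : IsNonGaussianStable α β m₁ m₂ (P.map X)) (g : ℝ → ℝ) (hg : SteinTestFunction g) :
    (∀ x : ℝ, Integrable (fun u : ℝ => stableSteinIntegrand α g x u)
      (stableLevyMeasure α m₁ m₂)) ∧
    Integrable (fun w => stableSteinOperator α β m₁ m₂ g (X w)) P ∧
    ∫ w, stableSteinOperator α β m₁ m₂ g (X w) ∂P = 0 := by
  obtain ⟨h0, h2, h₁, h₂, -, hμprob, hchar⟩ := hX
  have hν := integrable_min_stableLevyMeasure h0 h2 h₁ h₂
  obtain ⟨f, hf⟩ := hg.toSchwartz.exists_oscIntegral_eq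
  have hfg : oscIntegral f = fun x => (g x : ℂ) := funext hf
  have hc : Continuous (oscIntegral f) := continuous_oscIntegral f.integrable
  have hG : Integrable (oscIntegral f) := by
    rw [show oscIntegral f = hg.toSchwartz from funext hf]
    exact hg.toSchwartz.integrable
  have hb := integrable_compIncrement_and_integral_norm_le h0 h2 h₁ h₂ hc hG
    (L := ∫ t, |t| * ‖f t‖) (integral_nonneg fun t => by positivity)
    (norm_oscIntegral_add_sub_le f)
  have hint : ∀ x, Integrable (compIncrement (fun y => (g y : ℂ)) x)
      (stableLevyMeasure α m₁ m₂) := fun x => hfg ▸ (hb x).1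
  set γ := β + ∫ u, driftIntegrand u ∂(stableLevyMeasure α m₁ m₂) with hγ
  set A := stableSteinOperator α β m₁ m₂ g with hA
  have hop : ∀ x, (A x : ℂ) = (x - (γ : ℂ)) * oscIntegral f x -
      ∫ u, compIncrement (oscIntegral f) x u ∂(stableLevyMeasure α m₁ m₂) := fun x => by
    rw [hfg]; exact ofReal_stableSteinOperator h0 h2 h₁ h₂ (hint x)
  have hm := measurable_integral_compIncrement (ν := stableLevyMeasure α m₁ m₂) hc
  have hAm : Measurable A := by
    have : A = fun x => ((x - (γ : ℂ)) * oscIntegral f x -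
        ∫ u, compIncrement (oscIntegral f) x u ∂(stableLevyMeasure α m₁ m₂)).re :=
      funext fun x => by rw [← hop, Complex.ofReal_re]
    rw [this]
    have := hc.measurable
    fun_prop
  have hI1 : Integrable (fun x : ℝ => (x - (γ : ℂ)) * oscIntegral f x) (P.map X) := by
    have := ((integrable_oscIntegral f.integrable_deriv (P.map X)).const_mul Complex.I).sub
      ((integrable_oscIntegral f.integrable (P.map X)).const_mul (γ : ℂ))
    refine this.congr (ae_of_all _ fun x => ?_)
    simp only [Pi.sub_apply]
    rw [sub_mul, mul_oscIntegral]
  have hI2 : Integrable (fun x => ∫ u, compIncrement (oscIntegral f) x u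
      ∂(stableLevyMeasure α m₁ m₂)) (P.map X) :=
    (integrable_const _).mono' hm.aestronglyMeasurable
      (ae_of_all _ fun x => (norm_integral_le_integral_norm _).trans (hb x).2)
  have hIA : Integrable A (P.map X) := by
    rw [← integrable_ofReal_iff]
    simp only [hop]
    exact hI1.sub hI2
  refine ⟨fun x => integrable_stableSteinIntegrand h₁ h₂ (hint x),
    hIA.comp_aemeasurable hXm, ?_⟩
  rw [← integral_map hXm hAm.aestronglyMeasurable, ← Complex.ofReal_inj,
    ← integral_complex_ofReal]
  simp only [hop]
  rw [integral_sub hI1 hI2, integral_compIncrement_stable h0 h2 h₁ h₂ (P.map X) γ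
    (fun t => (hchar t).trans (levyExp_drift hν β t)) f (fun x => (hb x).1) (fun x => (hb x).2),
    sub_self, Complex.ofReal_zero]
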